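/- A robust Markov decision process (RMDP) $\mathcal M=(S,A,\mathcal P,r)$ has finite sets $S$ of states and $A$ of actions, uncertainty sets $\mathcal P(s,a)\subseteq\mathcal D(S)$ of probability distributions on $S$, and rewards $r:S\times A\to\mathbb N$; action $a$ is available in $s$ if $\mathcal P(s,a)\neq\emptyset$, and every state has an available action. An agent policy $\pi$ maps finite histories $s_0a_0\dots s_n$ to distributions over the actions available in $s_n$; an environment policy $\tau$ maps histories $s_0a_0\dots s_na_n$ to elements of $\mathcal P(s_n,a_n)$. Together with an initial state $s$ they induce a probability measure on infinite paths $\rho = s_0a_0s_1a_1\dots$ with $s_0=s$ and hence the expectation $\mathbb E^{\pi,\tau}_s$ of the total reward $\mathsf{TR}(\rho)=\sum_{t\ge 0} r(s_t,a_t)\in[0,\infty]$. The value is $V^{\max}(s)=\sup_\pi\inf_\tau\mathbb E^{\pi,\tau}_s[\mathsf{TR}]$ or $V^{\min}(s)=\inf_\pi\sup_\tau\mathbb E^{\pi,\tau}_s[\mathsf{TR}]$. The RMDP is polytopic if every $\mathcal P(s,a)$ is the convex hull of finitely many points; it is closed constant-support if every $\mathcal P(s,a)$ is closed and any two distributions in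 the same $\mathcal P(s,a)$ have the same support. A procedure on RMDPs is an algorithm which is given $\mathit{opt}\in\{\max,\min\}$, the available state-action pairs and their rewards, and which accesses the uncertainty sets only by optimizing linear functions over them: it may compare exactly the optimal values $\max_{p}$ or $\min_{p}$, $p\in\mathcal P(s,a)$, of two functions $\sum_{s'}c_{s'}p(s')$ with integer coefficients $c$ (the two functions may be optimized over different uncertainty sets). The next comparison, or the final output, is a (Turing) computable function of the input and of the answers obtained so far. **Lemma (INIT_TR).** There is a single procedure $\mathsf{INIT\_TR}$ which, for every RMDP $\mathcal M$ that is polytopic or closed constant-support and every $\mathit{opt}\in\{\max,\min\}$, terminates and outputs functions $\mathsf L,\mathsf U:S\to\mathbb Q\cup\{\infty\}$ such that (i) every state $s$ with $V^{\mathit{opt}}(s)=\infty$ has $\mathsf L(s)=\mathsf U(s)=\infty$, and (ii) every state $s$ with $V^{\mathit{opt}}(s)<\infty$ has $\mathsf L(s)=0$ and $\mathsf U(s)=t$, where $t\in\mathbb Q$ (the same for all these states) satisfies $V^{\mathit{opt}}(s')\le t$ for every state $s'$ of finite value. -/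

import Mathlib

open MeasureTheory ProbabilityTheory
open scoped ENNReal NNReal

/-! ## Robust Markov decision processes -/

/-- A robust MDP with state set `S`, action set `A`, uncertainty sets `unc s a` (sets of probability
distributions on `S`, written as vectors of probabilities) and rewards in `ℕ`.  An action is
available in a state iff its uncertainty set there is nonempty; every state has an available
action. -/
structure RMDP (S A : Type) [Fintype S] where
  unc : S → A → Set (S → ℝ)
  unc_subset : ∀ s a, unc s a ⊆ stdSimplex ℝ S
  reward : S → A → ℕ
  exists_available : ∀ s, ∃ a, (unc s a).Nonempty

namespace RMDP

variable {S A : Type} [Fintype S]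

/-- `a ∈ A(s)`. -/
def Available (M : RMDP S A) (s : S) (a : A) : Prop := (M.unc s a).Nonempty

/-- Every uncertainty set is a polytope, i.e. the convex hull of finitely many points. -/
def IsPolytopic (M : RMDP S A) : Prop :=
  ∀ s a, ∃ V : Set (S → ℝ), V.Finite ∧ M.unc s a = convexHull ℝ V

/-- Every uncertainty set is closed. -/
def IsClosed (M : RMDP S A) : Prop := ∀ s a, _root_.IsClosed (M.unc s a)

/-- Any two distributions in the same uncertainty set have the same support. -/
def ConstantSupport (M : RMDP S A) : Prop :=
  ∀ s a, ∀ p ∈ M.unc s a, ∀ q ∈ M.unc s a, {s' | 0 < p s'} = {s' | 0 < q s'}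

/-! ### Policies -/

/-- Agent policies: after `n` steps with history `h = s₀ a₀ … sₙ₋₁ aₙ₋₁` and in the current state
`s`, the policy yields a distribution over the actions available in `s`. -/
structure AgentPolicy (M : RMDP S A) where
  act : (n : ℕ) → (Fin n → S × A) → S → PMF A
  act_available : ∀ n h s, ∀ a ∈ (act n h s).support, M.Available s a

/-- Environment policies: after the history `h = s₀ a₀ … sₙ aₙ`, the policy yields an element of the
uncertainty set of `(sₙ, aₙ)`. Histories ending with an unavailable action never occur, and the
value of the policy on them is irrelevant. -/
structure EnvPolicy (M : RMDP S A) where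
  choose : (n : ℕ) → (Fin (n + 1) → S × A) → PMF S
  choose_mem : ∀ n h, M.Available (h (Fin.last n)).1 (h (Fin.last n)).2 →
    (fun s' => (choose n h s').toReal) ∈ M.unc (h (Fin.last n)).1 (h (Fin.last n)).2

/-! ### The probability measure on infinite paths -/

section Measure

variable [Fintype A] [MeasurableSpace S] [DiscreteMeasurableSpace S]
  [MeasurableSpace A] [DiscreteMeasurableSpace A] {M : RMDP S A}

/-- The distribution of the next state-action pair `(sₙ₊₁, aₙ₊₁)` after the history
`s₀ a₀ … sₙ aₙ`: the environment picks a distribution, the state `sₙ₊₁` is sampled from it, and then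
the agent's policy is sampled. -/
noncomputable def step (π : M.AgentPolicy) (τ : M.EnvPolicy) (n : ℕ) (h : Fin (n + 1) → S × A) :
    PMF (S × A) :=
  (τ.choose n h).bind fun s' => (π.act (n + 1) h s').map fun a' => (s', a')

/-- `step` as a Markov kernel from histories to state-action pairs. -/
noncomputable def stepKernel (π : M.AgentPolicy) (τ : M.EnvPolicy) (n : ℕ) :
    Kernel ((_ : Finset.Iic n) → S × A) (S × A) :=
  Kernel.ofFunOfCountable fun x =>
    (step π τ n fun i => x ⟨i, Finset.mem_Iic.2 (Nat.lt_succ_iff.1 i.2)⟩).toMeasure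

instance (π : M.AgentPolicy) (τ : M.EnvPolicy) (n : ℕ) : IsMarkovKernel (stepKernel π τ n) :=
  ⟨fun x => PMF.toMeasure.isProbabilityMeasure
    (step π τ n fun i => x ⟨i, Finset.mem_Iic.2 (Nat.lt_succ_iff.1 i.2)⟩)⟩

/-- The probability measure on infinite paths `s₀ a₀ s₁ a₁ …` with `s₀ = s` induced by a pair of
policies (by the Ionescu-Tulcea theorem). -/
noncomputable def pathMeasure (π : M.AgentPolicy) (τ : M.EnvPolicy) (s : S) :
    Measure (ℕ → S × A) :=
  (π.act 0 Fin.elim0 s).toMeasure.bind fun a =>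
    Kernel.traj (X := fun _ => S × A) (stepKernel π τ) 0 fun _ => (s, a)

end Measure

/-! ### Total reward and optimal values -/

/-- The (undiscounted) total reward of an infinite path. -/
noncomputable def totalReward (M : RMDP S A) (ρ : ℕ → S × A) : ℝ≥0∞ :=
  ∑' t, (M.reward (ρ t).1 (ρ t).2 : ℝ≥0∞)

end RMDP

/-- The optimization direction of the agent (the environment optimizes in the other direction). -/
inductive Opt
  | max
  | min

/-- Used to encode a direction in the input of a procedure. -/
def Opt.equivBool : Opt ≃ Bool where
  toFun | .max => true | .min => false
  invFun | true => .max | false => .min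
  left_inv o := by cases o <;> rfl
  right_inv b := by cases b <;> rfl

instance : Primcodable Opt := Primcodable.ofEquiv Bool Opt.equivBool

namespace RMDP

variable {S A : Type} [Fintype S]

section Value

variable [Fintype A] [MeasurableSpace S] [DiscreteMeasurableSpace S]
  [MeasurableSpace A] [DiscreteMeasurableSpace A]

/-- The expected total reward from `s` under a pair of policies. -/
noncomputable def policyValue (M : RMDP S A) (π : M.AgentPolicy) (τ : M.EnvPolicy) (s : S) :
    ℝ≥0∞ :=
  ∫⁻ ρ, M.totalReward ρ ∂pathMeasure π τ s

/-- The optimal value: `sup_π inf_τ` for a maximizing agent, `inf_π sup_τ` for a minimizing one. -/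
noncomputable def value (M : RMDP S A) : Opt → S → ℝ≥0∞
  | .max, s => ⨆ π : M.AgentPolicy, ⨅ τ : M.EnvPolicy, M.policyValue π τ s
  | .min, s => ⨅ π : M.AgentPolicy, ⨆ τ : M.EnvPolicy, M.policyValue π τ s

end Value

end RMDP

/-! ## Procedures on RMDPs

A procedure works on RMDPs with states `0, …, n - 1` and actions `0, …, m - 1`. Its input is the
finite data: the direction `opt` and the table of available actions and rewards. It has access to
the uncertainty sets only by optimizing linear functions over them: it may compare the optima of
two such linear functions (exactly). Everything else is Turing computation: the next comparison to
make, or the final output, is a computable function of the input and of the finitely many answers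
obtained so far. -/

/-- Row `s`, column `a` of the table is `some (reward s a)` if `a` is available in `s`, and `none`
otherwise. -/
abbrev RewardTable : Type := List (List (Option ℕ))

open Classical in
/-- The finite data of an RMDP. -/
noncomputable def RMDP.table {n m : ℕ} (M : RMDP (Fin n) (Fin m)) : RewardTable :=
  List.ofFn fun s => List.ofFn fun a => if M.Available s a then some (M.reward s a) else none

/-- `(o, s, a, c)` stands for the linear optimization problem `o_{p ∈ unc s a} ∑ s', c s' * p s'`,
with `o` being `max` or `min` and with integer coefficients `c`. -/
abbrev LinearProblem : Type := Opt × ℕ × ℕ × List ℤ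

/-- The optimum of a linear function over an uncertainty set (missing coefficients are `0`, and the
value is `0` if there is no such state-action pair). -/
noncomputable def RMDP.optimum {n m : ℕ} (M : RMDP (Fin n) (Fin m)) : LinearProblem → ℝ
  | (o, s, a, c) =>
    if h : s < n ∧ a < m then
      let values : Set ℝ :=
        (fun p : Fin n → ℝ => ∑ s' : Fin n, (c.getD s' 0 : ℝ) * p s') '' M.unc ⟨s, h.1⟩ ⟨a, h.2⟩
      match o with
      | .max => sSup values
      | .min => sInf values
    else 0

open Classical in
/-- The answer to the question whether the first optimum is at most the second. Since
`∑ s', p s' = 1`, the optimum of the constant function `c` is `c`, and since optima are positively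
homogeneous, this covers the comparison of optima of linear functions with rational coefficients,
with each other and with rational numbers. -/
noncomputable def RMDP.answer {n m : ℕ} (M : RMDP (Fin n) (Fin m))
    (q : LinearProblem × LinearProblem) : Bool :=
  decide (M.optimum q.1 ≤ M.optimum q.2)

/-- Nonnegative extended rationals, as output by a procedure: `none` stands for `∞`, and
`some (a, b)` for the fraction `a / (b + 1)`. -/
abbrev BoundCode : Type := Option (ℕ × ℕ)

/-- The number denoted by a code. -/
def BoundCode.denote : BoundCode → WithTop ℚ
  | none => ⊤
  | some (a, b) => (((a : ℚ) / ((b : ℚ) + 1) : ℚ) : WithTop ℚ)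

/-- A procedure that outputs, for every state, a lower and an upper bound. -/
structure Procedure where
  /-- The next comparison to make, or the output, from the input and the answers so far. -/
  next : (Opt × RewardTable) × List Bool →
    (LinearProblem × LinearProblem) ⊕ (List BoundCode × List BoundCode)
  computable_next : Computable next

/-- When run on `M` with direction `opt`, the procedure halts after finitely many comparisons (each
answered correctly) and outputs `L` and `U`. -/
def Procedure.Computes (P : Procedure) {n m : ℕ} (M : RMDP (Fin n) (Fin m)) (opt : Opt)
    (L U : Fin n → WithTop ℚ) : Prop :=
  ∃ answers : List Bool, ∃ l u : List BoundCode,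
    (∀ (k : ℕ) (hk : k < answers.length), ∃ q,
      P.next ((opt, M.table), answers.take k) = Sum.inl q ∧ answers[k] = M.answer q) ∧
    P.next ((opt, M.table), answers) = Sum.inr (l, u) ∧
    l.map BoundCode.denote = List.ofFn L ∧ u.map BoundCode.denote = List.ofFn U

/-! ### Expectations along the trajectories of a sequence of kernels -/

section Traj

open Finset Preorder

variable {Y : Type} [MeasurableSpace Y] [Countable Y] [DiscreteMeasurableSpace Y]
  {κ : (n : ℕ) → Kernel ((_ : Iic n) → Y) Y} [∀ n, IsMarkovKernel (κ n)]

/-- Append a point to a history. -/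
def extendHistory {Y : Type} {n : ℕ} (x : (_ : Iic n) → Y) (y : Y) : (_ : Iic (n + 1)) → Y :=
  fun i => if h : i.1 ≤ n then x ⟨i.1, mem_Iic.2 h⟩ else y

omit [Countable Y] in
theorem lintegral_traj_prefix {t : ℕ} (x : (_ : Iic t) → Y) (f : Y → ℝ≥0∞) {i : ℕ} (hi : i ≤ t) :
    ∫⁻ ρ, f (ρ i) ∂Kernel.traj (X := fun _ => Y) κ t x = f (x ⟨i, mem_Iic.2 hi⟩) := by
  rw [Kernel.lintegral_traj (X := fun _ => Y) x (f := fun ρ => f (ρ i))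
    (Measurable.of_discrete.comp (measurable_pi_apply i))]
  simp [Function.updateFinset, hi]

theorem lintegral_traj_succ {t : ℕ} (x : (_ : Iic t) → Y) {f : (ℕ → Y) → ℝ≥0∞}
    (hf : Measurable f) :
    ∫⁻ ρ, f ρ ∂Kernel.traj (X := fun _ => Y) κ t x =
      ∫⁻ y, ∫⁻ ρ, f ρ ∂Kernel.traj (X := fun _ => Y) κ (t + 1) (extendHistory x y) ∂κ t x := by
  have hg : Measurable fun z : (_ : Iic (t + 1)) → Y =>
      ∫⁻ ρ, f ρ ∂Kernel.traj (X := fun _ => Y) κ (t + 1) z := hf.lintegral_kernel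
  have hκ : IsSFiniteKernel ((κ t).map (MeasurableEquiv.piSingleton (X := fun _ => Y) t)) :=
    inferInstance
  have h1 : ∫⁻ ρ, f ρ ∂Kernel.traj (X := fun _ => Y) κ t x =
      ∫⁻ z, ∫⁻ ρ, f ρ ∂Kernel.traj (X := fun _ => Y) κ (t + 1) z
        ∂Kernel.partialTraj (X := fun _ => Y) κ t (t + 1) x := by
    rw [← Kernel.lintegral_comp _ _ _ hf, Kernel.traj_comp_partialTraj (Nat.le_succ t)]
  have hg' : Measurable fun a : ((_ : Iic t) → Y) × ((_ : Ioc t (t + 1)) → Y) =>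
      ∫⁻ ρ, f ρ ∂Kernel.traj (X := fun _ => Y) κ (t + 1)
        (IicProdIoc (X := fun _ => Y) t (t + 1) a) :=
    hg.comp (measurable_IicProdIoc (X := fun _ => Y))
  have hx : Measurable fun b : (_ : Ioc t (t + 1)) → Y =>
      ∫⁻ ρ, f ρ ∂Kernel.traj (X := fun _ => Y) κ (t + 1)
        (IicProdIoc (X := fun _ => Y) t (t + 1) (x, b)) := hg'.comp measurable_prodMk_left
  rw [h1, Kernel.partialTraj_succ_self, Kernel.lintegral_map _ (by fun_prop) _ hg,
    Kernel.lintegral_id_prod hg', Kernel.lintegral_map _ (by fun_prop) _ hx]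
  refine lintegral_congr fun y => ?_
  have : IicProdIoc (X := fun _ => Y) t (t + 1) (x, MeasurableEquiv.piSingleton (X := fun _ => Y) t y) =
      extendHistory x y := by
    funext ⟨i, hi⟩
    by_cases h : i ≤ t
    · simp [IicProdIoc, extendHistory, h]
    · obtain rfl : i = t + 1 := by have := mem_Iic.1 hi; omega
      simp [IicProdIoc, extendHistory, MeasurableEquiv.piSingleton]
  rw [this]

/-- The expected reward collected in `k` steps from time `t` on. -/
noncomputable def rewardToGo (κ : (n : ℕ) → Kernel ((_ : Iic n) → Y) Y) [∀ n, IsMarkovKernel (κ n)]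
    (r : Y → ℝ≥0∞) (k t : ℕ) (x : (_ : Iic t) → Y) : ℝ≥0∞ :=
  ∫⁻ ρ, ∑ i ∈ range k, r (ρ (t + i)) ∂Kernel.traj (X := fun _ => Y) κ t x

omit [Countable Y] in
theorem measurable_comp_eval (r : Y → ℝ≥0∞) (i : ℕ) : Measurable fun ρ : ℕ → Y => r (ρ i) :=
  Measurable.of_discrete.comp (measurable_pi_apply i)

theorem rewardToGo_succ (r : Y → ℝ≥0∞) (k t : ℕ) (x : (_ : Iic t) → Y) :
    rewardToGo κ r (k + 1) t x = r (x ⟨t, mem_Iic.2 le_rfl⟩) +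
      ∫⁻ y, rewardToGo κ r k (t + 1) (extendHistory x y) ∂κ t x := by
  unfold rewardToGo
  simp_rw [sum_range_succ' _ k, add_zero]
  rw [lintegral_add_right _ (measurable_comp_eval r t), add_comm, lintegral_traj_prefix x r le_rfl,
    lintegral_traj_succ x (by
      exact Finset.measurable_sum _ fun i _ => measurable_comp_eval r _)]
  simp only [add_assoc, add_comm 1]

omit [Countable Y] in
theorem lintegral_tsum_eq_iSup_rewardToGo (r : Y → ℝ≥0∞) (x : (_ : Iic 0) → Y) :
    ∫⁻ ρ, ∑' i, r (ρ i) ∂Kernel.traj (X := fun _ => Y) κ 0 x = ⨆ k, rewardToGo κ r k 0 x := by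
  rw [lintegral_tsum fun i => (measurable_comp_eval r i).aemeasurable, ENNReal.tsum_eq_iSup_nat]
  refine iSup_congr fun k => ?_
  unfold rewardToGo
  simp only [zero_add]
  rw [lintegral_finsetSum _ fun i _ => measurable_comp_eval r i]

theorem rewardToGo_le {r : Y → ℝ≥0∞} {q : (t : ℕ) → ((_ : Iic t) → Y) → ℝ≥0∞}
    (hq : ∀ t x, r (x ⟨t, mem_Iic.2 le_rfl⟩) + ∫⁻ y, q (t + 1) (extendHistory x y) ∂κ t x ≤ q t x)
    (k t : ℕ) (x : (_ : Iic t) → Y) : rewardToGo κ r k t x ≤ q t x := by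
  induction k generalizing t with
  | zero => simp [rewardToGo]
  | succ k ih =>
    rw [rewardToGo_succ]
    exact le_trans (by gcongr; exact ih _ _) (hq t x)

theorem le_rewardToGo {r : Y → ℝ≥0∞} {q : (k t : ℕ) → ((_ : Iic t) → Y) → ℝ≥0∞}
    (h0 : ∀ t x, q 0 t x ≤ 0)
    (hq : ∀ k t x, q (k + 1) t x ≤
      r (x ⟨t, mem_Iic.2 le_rfl⟩) + ∫⁻ y, q k (t + 1) (extendHistory x y) ∂κ t x)
    (k t : ℕ) (x : (_ : Iic t) → Y) : q k t x ≤ rewardToGo κ r k t x := by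
  induction k generalizing t with
  | zero => exact (h0 t x).trans zero_le
  | succ k ih =>
    rw [rewardToGo_succ]
    exact (hq k t x).trans (by gcongr; exact ih _ _)

end Traj

/-! ### Expectations of discrete distributions -/

theorem PMF.lintegral_toMeasure {α : Type*} [Countable α] [MeasurableSpace α]
    [DiscreteMeasurableSpace α] (p : PMF α) (f : α → ℝ≥0∞) :
    ∫⁻ a, f a ∂p.toMeasure = ∑' a, p a * f a := by
  rw [lintegral_countable']
  exact tsum_congr fun a => by
    rw [p.toMeasure_apply_singleton a (MeasurableSet.of_discrete), mul_comm]

theorem PMF.tsum_bind_mul {α β : Type*} (p : PMF α) (g : α → PMF β) (f : β → ℝ≥0∞) :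
    ∑' b, (p.bind g) b * f b = ∑' a, p a * ∑' b, g a b * f b := by
  simp_rw [PMF.bind_apply, ← ENNReal.tsum_mul_right, ← ENNReal.tsum_mul_left]
  rw [ENNReal.tsum_comm]
  simp_rw [mul_assoc]

theorem PMF.tsum_map_mul {α β : Type*} (p : PMF α) (g : α → β) (f : β → ℝ≥0∞) :
    ∑' b, (p.map g) b * f b = ∑' a, p a * f (g a) := by
  rw [← PMF.bind_pure_comp, PMF.tsum_bind_mul]
  refine tsum_congr fun a => ?_
  rw [tsum_eq_single (g a)]
  · simp
  · intro b hb
    simp [PMF.pure_apply, hb]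

theorem PMF.tsum_mul_le {α : Type*} (p : PMF α) {f : α → ℝ≥0∞} {c : ℝ≥0∞}
    (h : ∀ a ∈ p.support, f a ≤ c) : ∑' a, p a * f a ≤ c := by
  calc ∑' a, p a * f a ≤ ∑' a, p a * c := by
        refine ENNReal.tsum_le_tsum fun a => ?_
        by_cases ha : a ∈ p.support
        · gcongr; exact h a ha
        · simp [(PMF.apply_eq_zero_iff p a).2 ha]
    _ = c := by rw [ENNReal.tsum_mul_right, p.tsum_coe, one_mul]

theorem PMF.le_tsum_mul {α : Type*} (p : PMF α) {f : α → ℝ≥0∞} {c : ℝ≥0∞}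
    (h : ∀ a ∈ p.support, c ≤ f a) : c ≤ ∑' a, p a * f a := by
  calc c = ∑' a, p a * c := by rw [ENNReal.tsum_mul_right, p.tsum_coe, one_mul]
    _ ≤ ∑' a, p a * f a := by
        refine ENNReal.tsum_le_tsum fun a => ?_
        by_cases ha : a ∈ p.support
        · gcongr; exact h a ha
        · simp [(PMF.apply_eq_zero_iff p a).2 ha]

/-! ### Bounds on the expected total reward -/

/-- The expectation of `U` under the distribution with probability vector `p`. -/
noncomputable def dot {S : Type} [Fintype S] (p : S → ℝ) (U : S → ℝ≥0∞) : ℝ≥0∞ :=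
  ∑ s', ENNReal.ofReal (p s') * U s'

theorem PMF.dot_toReal {S : Type} [Fintype S] (p : PMF S) (U : S → ℝ≥0∞) :
    dot (fun s' => (p s').toReal) U = ∑' s', p s' * U s' := by
  rw [tsum_fintype, dot]
  exact Finset.sum_congr rfl fun s' _ => by rw [ENNReal.ofReal_toReal (p.apply_ne_top s')]

namespace RMDP

section History

variable {S A : Type}

/-- A history indexed by `Fin`. -/
def finHistory {n : ℕ} (x : (_ : Finset.Iic n) → S × A) : Fin (n + 1) → S × A :=
  fun i => x ⟨i, Finset.mem_Iic.2 (Nat.lt_succ_iff.1 i.2)⟩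

theorem finHistory_extend {n : ℕ} (x : (_ : Finset.Iic n) → S × A) (y : S × A) :
    finHistory (extendHistory x y) = Fin.snoc (α := fun _ => S × A) (finHistory x) y := by
  funext i
  induction i using Fin.lastCases with
  | last => simp [finHistory, extendHistory]
  | cast i => simp [finHistory, extendHistory, Nat.lt_succ_iff.1 i.2]

end History

variable {S A : Type} [Fintype S] [Fintype A] [MeasurableSpace S] [DiscreteMeasurableSpace S]
  [MeasurableSpace A] [DiscreteMeasurableSpace A] {M : RMDP S A}

/-- In every state `s`, all actions and distributions chosen by `π` and `τ` are in `C s`. -/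
def Consistent (π : M.AgentPolicy) (τ : M.EnvPolicy) (C : S → Set (A × (S → ℝ))) : Prop :=
  ∀ n (h : Fin n → S × A) s, ∀ a ∈ (π.act n h s).support,
    (a, fun s' => (τ.choose n (Fin.snoc h (s, a)) s').toReal) ∈ C s

theorem lintegral_stepKernel (π : M.AgentPolicy) (τ : M.EnvPolicy) (n : ℕ)
    (x : (_ : Finset.Iic n) → S × A) (f : S × A → ℝ≥0∞) :
    ∫⁻ y, f y ∂stepKernel π τ n x = ∑' s', τ.choose n (finHistory x) s' *
      ∑' a', π.act (n + 1) (finHistory x) s' a' * f (s', a') := by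
  change ∫⁻ y, f y ∂(step π τ n (finHistory x)).toMeasure = _
  rw [PMF.lintegral_toMeasure, step, PMF.tsum_bind_mul]
  simp_rw [PMF.tsum_map_mul]

theorem policyValue_eq (π : M.AgentPolicy) (τ : M.EnvPolicy) (s : S) :
    M.policyValue π τ s = ∑' a, π.act 0 Fin.elim0 s a *
      ⨆ k, rewardToGo (stepKernel π τ) (fun y => (M.reward y.1 y.2 : ℝ≥0∞)) k 0
        (fun _ => (s, a)) := by
  have hm : Measurable M.totalReward :=
    Measurable.tsum fun i => measurable_comp_eval (fun y : S × A => (M.reward y.1 y.2 : ℝ≥0∞)) i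
  rw [policyValue, pathMeasure, Measure.lintegral_bind Measurable.of_discrete.aemeasurable
    hm.aemeasurable, PMF.lintegral_toMeasure]
  simp only [totalReward]
  simp_rw [lintegral_tsum_eq_iSup_rewardToGo (κ := stepKernel π τ)
    (fun y => (M.reward y.1 y.2 : ℝ≥0∞))]

/-- The reward of the last step of a history plus the expectation of `U` at the next state. -/
noncomputable def histQ (τ : M.EnvPolicy) (U : S → ℝ≥0∞) (t : ℕ)
    (x : (_ : Finset.Iic t) → S × A) : ℝ≥0∞ :=
  M.reward (x ⟨t, Finset.mem_Iic.2 le_rfl⟩).1 (x ⟨t, Finset.mem_Iic.2 le_rfl⟩).2 +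
    ∑' s', τ.choose t (finHistory x) s' * U s'

omit [Fintype A] [MeasurableSpace S] [DiscreteMeasurableSpace S] [MeasurableSpace A]
  [DiscreteMeasurableSpace A] in
theorem Consistent.histQ_extend {π : M.AgentPolicy} {τ : M.EnvPolicy}
    {C : S → Set (A × (S → ℝ))} (hC : Consistent π τ C) (U : S → ℝ≥0∞) {t : ℕ}
    (x : (_ : Finset.Iic t) → S × A) (s : S) (a : A)
    (ha : a ∈ (π.act (t + 1) (finHistory x) s).support) :
    ∃ p, (a, p) ∈ C s ∧ histQ τ U (t + 1) (extendHistory x (s, a)) = M.reward s a + dot p U := by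
  refine ⟨_, hC (t + 1) (finHistory x) s a ha, ?_⟩
  rw [PMF.dot_toReal, histQ, finHistory_extend]
  simp [extendHistory]

omit [Fintype A] [MeasurableSpace S] [DiscreteMeasurableSpace S] [MeasurableSpace A]
  [DiscreteMeasurableSpace A] in
theorem Consistent.histQ_zero {π : M.AgentPolicy} {τ : M.EnvPolicy}
    {C : S → Set (A × (S → ℝ))} (hC : Consistent π τ C) (U : S → ℝ≥0∞) (s : S) (a : A)
    (ha : a ∈ (π.act 0 Fin.elim0 s).support) :
    ∃ p, (a, p) ∈ C s ∧ histQ τ U 0 (fun _ => (s, a)) = M.reward s a + dot p U := by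
  refine ⟨_, hC 0 Fin.elim0 s a ha, ?_⟩
  rw [PMF.dot_toReal, histQ]
  have : finHistory (fun _ => (s, a)) = Fin.snoc (α := fun _ => S × A) Fin.elim0 (s, a) := by
    funext i
    obtain rfl : i = Fin.last 0 := Fin.fin_one_eq_zero i
    exact (Fin.snoc_last (α := fun _ => S × A) (s, a) Fin.elim0).symm
  rw [this]

theorem Consistent.policyValue_le {π : M.AgentPolicy} {τ : M.EnvPolicy}
    {C : S → Set (A × (S → ℝ))} (hC : Consistent π τ C) {v : S → ℝ≥0∞}
    (hv : ∀ s, ∀ c ∈ C s, M.reward s c.1 + dot c.2 v ≤ v s) (s : S) :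
    M.policyValue π τ s ≤ v s := by
  rw [policyValue_eq]
  refine PMF.tsum_mul_le _ fun a ha => iSup_le fun k => ?_
  refine (rewardToGo_le (q := fun t x => histQ τ v t x) (fun t x => ?_) k 0 _).trans ?_
  · rw [lintegral_stepKernel, histQ]
    gcongr with s'
    refine PMF.tsum_mul_le _ fun a' ha' => ?_
    obtain ⟨p, hp, he⟩ := hC.histQ_extend v x s' a' ha'
    rw [he]
    exact hv s' _ hp
  · obtain ⟨p, hp, he⟩ := hC.histQ_zero v s a ha
    rw [he]
    exact hv s _ hp

theorem Consistent.le_policyValue {π : M.AgentPolicy} {τ : M.EnvPolicy}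
    {C : S → Set (A × (S → ℝ))} (hC : Consistent π τ C) {U : ℕ → S → ℝ≥0∞}
    (h0 : ∀ s, U 0 s = 0)
    (hU : ∀ n s, ∀ c ∈ C s, U (n + 1) s ≤ M.reward s c.1 + dot c.2 (U n)) (n : ℕ) (s : S) :
    U n s ≤ M.policyValue π τ s := by
  cases n with
  | zero => simp [h0]
  | succ n =>
  rw [policyValue_eq]
  refine PMF.le_tsum_mul _ fun a ha => le_iSup_of_le (n + 1) ?_
  let q : (k t : ℕ) → ((_ : Finset.Iic t) → S × A) → ℝ≥0∞ := fun k t x =>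
    if k = 0 then 0 else histQ τ (U (k - 1)) t x
  have key := le_rewardToGo (κ := stepKernel π τ) (r := fun y => (M.reward y.1 y.2 : ℝ≥0∞)) (q := q)
    (fun t x => by simp [q]) (fun k t x => ?_) (n + 1) 0 (fun _ => (s, a))
  · refine le_trans ?_ key
    obtain ⟨p, hp, he⟩ := hC.histQ_zero (U n) s a ha
    simp only [q, Nat.add_eq_zero_iff, one_ne_zero, and_false, if_false, Nat.add_sub_cancel, he]
    exact hU n s _ hp
  · rw [lintegral_stepKernel]
    simp only [q, Nat.add_eq_zero_iff, one_ne_zero, and_false, if_false, Nat.add_sub_cancel]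
    rw [histQ]
    gcongr with s'
    refine PMF.le_tsum_mul _ fun a' ha' => ?_
    cases k with
    | zero => simp [h0]
    | succ k =>
      obtain ⟨p, hp, he⟩ := hC.histQ_extend (U k) x s' a' ha'
      simp only [Nat.add_eq_zero_iff, one_ne_zero, and_false, if_false, Nat.add_sub_cancel, he]
      exact hU k s' _ hp

end RMDP

/-! ### Determinacy of a qualitative game -/

/-- A maximal set that can be exhausted greedily: the sets `{ρ = j}` are added one after the other,
and adding a set `D` to the elements `B` that are already there requires `Q B D s` for all
`s ∈ D`. -/
theorem exists_maximal_ranking {S : Type*} [Finite S] (Q : Set S → Set S → S → Prop) :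
    ∃ (B : Set S) (ρ : S → ℕ),
      (∀ s ∈ B, Q {s' | s' ∈ B ∧ ρ s' < ρ s} {s' | s' ∈ B ∧ ρ s' = ρ s} s) ∧
      ∀ D : Set S, D.Nonempty → (∀ s ∈ D, s ∉ B) → ∃ s ∈ D, ¬Q B D s := by
  classical
  let F : Set (Set S) := {B | ∃ ρ : S → ℕ,
    ∀ s ∈ B, Q {s' | s' ∈ B ∧ ρ s' < ρ s} {s' | s' ∈ B ∧ ρ s' = ρ s} s}
  obtain ⟨B, hB⟩ := (Set.toFinite F).exists_maximal ⟨∅, fun _ => 0, by simp⟩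
  obtain ⟨ρ, hρ⟩ := hB.prop
  refine ⟨B, ρ, hρ, fun D hD hDB => ?_⟩
  by_contra! hQ
  obtain ⟨N, hN⟩ : ∃ N, ∀ s, ρ s < N := by
    obtain ⟨N, hN⟩ := (Set.finite_range ρ).bddAbove
    exact ⟨N + 1, fun s => Nat.lt_succ_of_le (hN ⟨s, rfl⟩)⟩
  have hmem : B ∪ D ∈ F := by
    refine ⟨fun s => if s ∈ B then ρ s else N, fun s hs => ?_⟩
    by_cases hsB : s ∈ B
    · convert hρ s hsB using 1 <;> ext s' <;> by_cases h' : s' ∈ B <;> simp [hsB, h']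
      · intro _; exact (hN s).le
      · intro _; exact (hN s).ne'
    · convert hQ s (hs.resolve_left hsB) using 1 <;> ext s' <;> by_cases h' : s' ∈ B <;>
        simp [hsB, h', hN]
      · exact ⟨fun h => absurd (h.elim id And.right) (hN s').ne, fun h => absurd h' (hDB _ h)⟩
  obtain ⟨s, hs⟩ := hD
  exact hDB s hs (hB.le_of_ge hmem Set.subset_union_left (Or.inr hs))

section Partition

variable {S β : Type*} (supp : β → Set S) (pos : β → Prop)

/-- The moves that make progress towards infinite reward: either a state of the set `I` is reached
with positive probability, or the move stays in `B` and a reward is collected or the set `L` is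
reached with positive probability. -/
def GoodMove (I B L : Set S) (b : β) : Prop :=
  (∃ s ∈ supp b, s ∈ I) ∨ ((∀ s ∈ supp b, s ∈ B) ∧ (pos b ∨ ∃ s ∈ supp b, s ∈ L))

/-- The moves that avoid `I` and either reach `L` with positive probability, or collect no reward
and stay in `D`. -/
def SafeMove (I L D : Set S) (b : β) : Prop :=
  (∀ s ∈ supp b, s ∉ I) ∧ ((∃ s ∈ supp b, s ∈ L) ∨ (¬pos b ∧ ∀ s ∈ supp b, s ∈ D))

/-- `Up s Φ` means that in the state `s`, the minimizer can ensure that the next move satisfies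
`Φ`. -/
theorem exists_good_safe_partition [Finite S] (Up : S → (β → Prop) → Prop)
    (mono : ∀ s Φ Ψ, (∀ b, Φ b → Ψ b) → Up s Φ → Up s Ψ) :
    ∃ (I : Set S) (k d ρ : S → ℕ),
      (∀ s ∈ I, ¬Up s fun b => ¬GoodMove supp pos {s' | s' ∈ I ∧ k s' < k s}
        {s' | s' ∈ I ∧ k s' = k s} {s' | d s' < d s} b) ∧
      ∀ s ∉ I, Up s (SafeMove supp pos I {s' | s' ∉ I ∧ ρ s' < ρ s}
        {s' | s' ∉ I ∧ ρ s' = ρ s}) := by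
  classical
  let P : Set S → Set S → (S → ℕ) → Prop := fun I B d =>
    ∀ s ∈ B, ¬Up s fun b => ¬GoodMove supp pos I B {s' | d s' < d s} b
  obtain ⟨I, k, hI, hImax⟩ := exists_maximal_ranking fun I B (_ : S) => ∃ d, P I B d
  obtain ⟨G, ρ, hG, hGmax⟩ := exists_maximal_ranking fun L D s =>
    s ∉ I ∧ Up s (SafeMove supp pos I L D)
  have hGI : ∀ s, s ∈ G ↔ s ∉ I := by
    refine fun s => ⟨fun hs => (hG s hs).1, fun hs => ?_⟩
    by_contra hsG
    let B : Set S := {s' | s' ∉ I ∧ s' ∉ G}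
    obtain ⟨T, d, hT, hTmax⟩ := exists_maximal_ranking fun T (_ : Set S) s =>
      s ∈ B ∧ ¬Up s fun b => ¬GoodMove supp pos I B T b
    have hTB : ∀ s ∈ B, s ∈ T := by
      by_contra! hne
      obtain ⟨s₀, hs₀, hs₀T⟩ := hne
      obtain ⟨s₁, ⟨hs₁, hs₁T⟩, hs₁'⟩ := hGmax {s' | s' ∈ B ∧ s' ∉ T} ⟨s₀, hs₀, hs₀T⟩
        fun s' hs' => hs'.1.2
      obtain ⟨s₂, rfl, hs₂⟩ := hTmax {s₁} ⟨s₁, rfl⟩ (by rintro _ rfl; exact hs₁T)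
      refine hs₂ ⟨hs₁, fun hUp => hs₁' ⟨hs₁.1, mono _ _ _ (fun b hb => ?_) hUp⟩⟩
      unfold GoodMove at hb
      push Not at hb
      refine ⟨hb.1, ?_⟩
      by_cases hbG : ∃ s' ∈ supp b, s' ∈ G
      · exact Or.inl hbG
      · push Not at hbG
        have := hb.2 fun s' hs' => ⟨hb.1 s' hs', hbG s' hs'⟩
        exact Or.inr ⟨this.1, fun s' hs' => ⟨⟨hb.1 s' hs', hbG s' hs'⟩, this.2 s' hs'⟩⟩
    obtain ⟨s', hs', hs''⟩ := hImax B ⟨s, hs, hsG⟩ fun s' hs' => hs'.1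
    refine hs'' ⟨d, fun s hsB hUp => (hT s (hTB s hsB)).2 (mono _ _ _ (fun b hb hgood => hb ?_) hUp)⟩
    exact hgood.imp id fun h => ⟨h.1, h.2.imp id fun ⟨s', hs', h'⟩ => ⟨s', hs', h'.2⟩⟩
  obtain rfl : G = Iᶜ := Set.ext hGI
  let layer : ℕ → Set S := fun j => {s' | s' ∈ I ∧ k s' = j}
  let below : ℕ → Set S := fun j => {s' | s' ∈ I ∧ k s' < j}
  let sel : ℕ → S → ℕ := fun j => if h : ∃ d, P (below j) (layer j) d then h.choose else 0
  refine ⟨I, k, fun s => sel (k s) s, ρ, fun s hs hUp => ?_, fun s hs => (hG s hs).2⟩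
  have h := hI s hs
  refine h.choose_spec s ⟨hs, rfl⟩ (mono _ _ _ (fun b hb hgood => hb ?_) hUp)
  refine hgood.imp id fun h' => ⟨h'.1, h'.2.imp id fun ⟨s', hs', hlt⟩ => ⟨s', hs', ?_⟩⟩
  have hk : k s' = k s := (h'.1 s' hs').2
  have hsel : sel (k s) = h.choose := dif_pos h
  change sel (k s') s' < sel (k s) s
  rw [hk, hsel]
  exact hlt

end Partition

/-! ### Value iteration with compact choice sets -/

section Dot

variable {S : Type} [Fintype S]

theorem dot_mono (p : S → ℝ) {U V : S → ℝ≥0∞} (h : ∀ s, U s ≤ V s) : dot p U ≤ dot p V :=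
  Finset.sum_le_sum fun s _ => by gcongr; exact h s

theorem dot_ne_top (p : S → ℝ) {U : S → ℝ≥0∞} (h : ∀ s, U s ≠ ⊤) : dot p U ≠ ⊤ :=
  ENNReal.sum_ne_top.2 fun s _ => ENNReal.mul_ne_top ENNReal.ofReal_ne_top (h s)

theorem dot_iSup (p : S → ℝ) {U : ℕ → S → ℝ≥0∞} (h : ∀ s, Monotone fun n => U n s) :
    dot p (fun s => ⨆ n, U n s) = ⨆ n, dot p (U n) := by
  unfold dot
  simp_rw [ENNReal.mul_iSup]
  exact ENNReal.finsetSum_iSup_of_monotone fun s i j hij => by gcongr; exact h s hij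

theorem continuous_dot {U : S → ℝ≥0∞} (h : ∀ s, U s ≠ ⊤) : Continuous fun p : S → ℝ => dot p U :=
  continuous_finsetSum _ fun s _ => (ENNReal.continuous_mul_const (h s)).comp
    (ENNReal.continuous_ofReal.comp (continuous_apply s))

theorem dot_eq_ofReal {p : S → ℝ} (hp : p ∈ stdSimplex ℝ S) {U : S → ℝ≥0∞}
    (h : ∀ s, 0 < p s → U s ≠ ⊤) : dot p U = ENNReal.ofReal (∑ s, p s * (U s).toReal) := by
  rw [ENNReal.ofReal_sum_of_nonneg fun s _ => mul_nonneg (hp.1 s) ENNReal.toReal_nonneg]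
  refine Finset.sum_congr rfl fun s _ => ?_
  rw [ENNReal.ofReal_mul (hp.1 s)]
  obtain h0 | h0 := (hp.1 s).eq_or_lt
  · simp [← h0]
  · rw [ENNReal.ofReal_toReal (h s h0)]

theorem dot_eq_top {p : S → ℝ} {U : S → ℝ≥0∞} {s : S} (h0 : 0 < p s) (h : U s = ⊤) :
    dot p U = ⊤ := by
  refine top_unique (le_trans ?_
    (Finset.single_le_sum (f := fun s => ENNReal.ofReal (p s) * U s) (fun _ _ => zero_le)
      (Finset.mem_univ s)))
  simp [h, ENNReal.mul_top, h0]

end Dot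

namespace RMDP

section ValueIteration

variable {S A : Type} [Fintype S] (M : RMDP S A)

/-- The successor states and the sign of the reward of a move. -/
def moveSupp (b : ℕ × (S → ℝ)) : Set S := {s' | 0 < b.2 s'}

/-- The reward of a move is positive. -/
def movePos (b : ℕ × (S → ℝ)) : Prop := 0 < b.1

/-- Value iteration for a minimizer who chooses in state `s` from the set `C s`. -/
noncomputable def iterate (C : S → Set (A × (S → ℝ))) : ℕ → S → ℝ≥0∞
  | 0 => fun _ => 0
  | n + 1 => fun s => ⨅ c ∈ C s, (M.reward s c.1 + dot c.2 (iterate C n))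

variable {M} {C : S → Set (A × (S → ℝ))}

theorem iterate_succ_le (n : ℕ) {s : S} {c : A × (S → ℝ)} (hc : c ∈ C s) :
    M.iterate C (n + 1) s ≤ M.reward s c.1 + dot c.2 (M.iterate C n) :=
  iInf₂_le c hc

theorem iterate_ne_top (hne : ∀ s, (C s).Nonempty) (n : ℕ) (s : S) : M.iterate C n s ≠ ⊤ := by
  induction n generalizing s with
  | zero => simp [iterate]
  | succ n ih =>
    obtain ⟨c, hc⟩ := hne s
    exact ne_top_of_le_ne_top (ENNReal.add_ne_top.2 ⟨ENNReal.natCast_ne_top _, dot_ne_top _ ih⟩)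
      (iterate_succ_le n hc)

theorem iterate_monotone (s : S) : Monotone fun n => M.iterate C n s := by
  refine monotone_nat_of_le_succ fun n => ?_
  induction n generalizing s with
  | zero => simp [iterate]
  | succ n ih =>
    exact le_iInf₂ fun c hc => (iterate_succ_le n hc).trans (by gcongr; exact dot_mono _ ih)

theorem exists_le_iSup_iterate [TopologicalSpace A] [DiscreteTopology A]
    (hne : ∀ s, (C s).Nonempty) {s : S} (hs : IsCompact (C s)) :
    ∃ c ∈ C s, M.reward s c.1 + dot c.2 (fun s' => ⨆ n, M.iterate C n s') ≤
      ⨆ n, M.iterate C n s := by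
  have hcont : ∀ n, Continuous fun c : A × (S → ℝ) =>
      (M.reward s c.1 : ℝ≥0∞) + dot c.2 (M.iterate C n) := fun n =>
    ((continuous_of_discreteTopology (f := fun a => (M.reward s a : ℝ≥0∞))).comp
      continuous_fst).add ((continuous_dot (iterate_ne_top hne n)).comp continuous_snd)
  let X : ℕ → Set (A × (S → ℝ)) := fun n =>
    {c | (M.reward s c.1 : ℝ≥0∞) + dot c.2 (M.iterate C n) ≤ ⨆ n, M.iterate C n s}
  have hX : ∀ n, _root_.IsClosed (X n) := fun n => isClosed_le (hcont n) continuous_const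
  obtain ⟨c, hc⟩ := IsCompact.nonempty_iInter_of_directed_nonempty_isCompact_isClosed
    (fun n => C s ∩ X n)
    ((antitone_nat_of_succ_le fun n c hc => ⟨hc.1, 
      (add_le_add le_rfl (dot_mono _ fun s => iterate_monotone s n.le_succ)).trans hc.2⟩ :
        Antitone fun n => C s ∩ X n).directed_ge)
    (fun n => by
      obtain ⟨c, hc, hmin⟩ := hs.exists_isMinOn (hne s) (hcont n).continuousOn
      exact ⟨c, hc, le_trans (le_iInf₂ fun c' hc' => hmin hc')
        (le_iSup (fun n => M.iterate C n s) (n + 1))⟩)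
    (fun n => hs.inter_right (hX n)) (fun n => hs.isClosed.inter (hX n))
  rw [Set.mem_iInter] at hc
  refine ⟨c, (hc 0).1, ?_⟩
  rw [dot_iSup _ fun s => iterate_monotone s, ENNReal.add_iSup]
  exact iSup_le fun n => (hc n).2

theorem iSup_iterate_eq_top [TopologicalSpace A] [DiscreteTopology A]
    (hne : ∀ s, (C s).Nonempty) {I : Set S} {k d : S → ℕ} (hcomp : ∀ s ∈ I, IsCompact (C s))
    (hgood : ∀ s ∈ I, ∀ c ∈ C s, c.2 ∈ stdSimplex ℝ S ∧ GoodMove moveSupp movePos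
      {s' | s' ∈ I ∧ k s' < k s} {s' | s' ∈ I ∧ k s' = k s} {s' | d s' < d s}
      (M.reward s c.1, c.2)) {s : S} (hs : s ∈ I) : ⨆ n, M.iterate C n s = ⊤ := by
  set W : S → ℝ≥0∞ := fun s => ⨆ n, M.iterate C n s with hW
  change W s = ⊤
  induction hj : k s using Nat.strong_induction_on generalizing s with
  | _ j ih =>
  by_contra hfin
  obtain ⟨s₀, ⟨hs₀, hk, hs₀fin⟩, hmin⟩ := Set.exists_min_image {s | s ∈ I ∧ k s = j ∧ W s ≠ ⊤}
    (fun s => toLex (W s, d s)) (Set.toFinite _) ⟨s, hs, hj, hfin⟩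
  obtain ⟨⟨a, p⟩, hc, hle⟩ := exists_le_iSup_iterate hne (hcomp s₀ hs₀)
  change (M.reward s₀ a : ℝ≥0∞) + dot p W ≤ W s₀ at hle
  obtain ⟨hp, hg⟩ := hgood s₀ hs₀ _ hc
  change p ∈ stdSimplex ℝ S at hp
  have hdot : dot p W ≠ ⊤ :=
    ne_top_of_le_ne_top hs₀fin (le_trans le_add_self hle)
  have hWfin : ∀ s', 0 < p s' → W s' ≠ ⊤ := fun s' h0 h => hdot (dot_eq_top h0 h)
  obtain ⟨s', h0, hs'I, hlt⟩ | ⟨hB, hprog⟩ := hg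
  · exact hWfin s' h0 (ih (k s') (hk ▸ hlt) hs'I rfl)
  have hlex : ∀ s', 0 < p s' → W s₀ < W s' ∨ W s₀ = W s' ∧ d s₀ ≤ d s' := fun s' h0 =>
    Prod.Lex.toLex_le_toLex.1 (hmin s' ⟨(hB s' h0).1, (hB s' h0).2.trans hk, hWfin s' h0⟩)
  have hterm : ∀ s' ∈ Finset.univ, 0 ≤ p s' * ((W s').toReal - (W s₀).toReal) := fun s' _ => by
    obtain h0 | h0 := (hp.1 s').eq_or_lt
    · rw [← h0, zero_mul]
    · refine mul_nonneg h0.le (sub_nonneg.2 (ENNReal.toReal_mono (hWfin s' h0) ?_))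
      exact (hlex s' h0).elim le_of_lt fun h => h.1.le
  have hsum : ∑ s', p s' * ((W s').toReal - (W s₀).toReal) + M.reward s₀ a ≤ 0 := by
    rw [dot_eq_ofReal hp hWfin] at hle
    have h := ENNReal.toReal_mono hs₀fin hle
    rw [ENNReal.toReal_add (ENNReal.natCast_ne_top _) ENNReal.ofReal_ne_top,
      ENNReal.toReal_ofReal (Finset.sum_nonneg fun s _ =>
        mul_nonneg (hp.1 s) ENNReal.toReal_nonneg), ENNReal.toReal_natCast] at h
    simp_rw [mul_sub, Finset.sum_sub_distrib, ← Finset.sum_mul, hp.2]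
    linarith
  have hnn := Finset.sum_nonneg hterm
  have hr : (0 : ℝ) ≤ M.reward s₀ a := Nat.cast_nonneg _
  obtain hpos | ⟨s', h0, hlt⟩ := hprog
  · have : (0 : ℝ) < M.reward s₀ a := Nat.cast_pos.2 hpos
    linarith
  · have hlt' : W s₀ < W s' := (hlex s' h0).resolve_right fun h => absurd hlt (not_lt.2 h.2)
    have h1 : 0 < p s' * ((W s').toReal - (W s₀).toReal) :=
      mul_pos h0 (sub_pos.2 (ENNReal.toReal_strict_mono (hWfin s' h0) hlt'))
    have h2 := Finset.single_le_sum hterm (Finset.mem_univ s')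
    linarith

theorem Consistent.policyValue_eq_top [Fintype A] [MeasurableSpace S] [DiscreteMeasurableSpace S]
    [MeasurableSpace A] [DiscreteMeasurableSpace A] [TopologicalSpace A] [DiscreteTopology A]
    {π : M.AgentPolicy} {τ : M.EnvPolicy} (hC : Consistent π τ C)
    (hne : ∀ s, (C s).Nonempty) {I : Set S} {k d : S → ℕ} (hcomp : ∀ s ∈ I, IsCompact (C s))
    (hgood : ∀ s ∈ I, ∀ c ∈ C s, c.2 ∈ stdSimplex ℝ S ∧ GoodMove moveSupp movePos
      {s' | s' ∈ I ∧ k s' < k s} {s' | s' ∈ I ∧ k s' = k s} {s' | d s' < d s}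
      (M.reward s c.1, c.2)) {s : S} (hs : s ∈ I) : M.policyValue π τ s = ⊤ := by
  refine top_unique ((iSup_iterate_eq_top hne hcomp hgood hs).symm.le.trans (iSup_le fun n => ?_))
  exact hC.le_policyValue (fun _ => rfl) (fun n s c hc => iterate_succ_le n hc) n s

end ValueIteration

end RMDP

/-! ### Bounds on the optimal values from positional strategies -/

namespace RMDP

section Ensures

variable {S A : Type} [Fintype S] (M : RMDP S A)

/-- The minimizing player has a choice in `s` such that the next move satisfies `Φ`, where the
environment chooses from the sets `P s a`. -/
def MinEnsures (P : S → A → Set (S → ℝ)) (opt : Opt) (s : S) (Φ : ℕ × (S → ℝ) → Prop) : Prop :=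
  match opt with
  | .min => ∃ a, M.Available s a ∧ ∀ p ∈ P s a, Φ (M.reward s a, p)
  | .max => ∀ a, M.Available s a → ∃ p ∈ P s a, Φ (M.reward s a, p)

/-- The maximizing player has a choice in `s` such that the next move satisfies `Φ`, where the
environment chooses from the sets `P s a`. -/
def MaxEnsures (P : S → A → Set (S → ℝ)) (opt : Opt) (s : S) (Φ : ℕ × (S → ℝ) → Prop) : Prop :=
  match opt with
  | .min => ∀ a, M.Available s a → ∃ p ∈ P s a, Φ (M.reward s a, p)
  | .max => ∃ a, M.Available s a ∧ ∀ p ∈ P s a, Φ (M.reward s a, p)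

variable {M}

theorem MinEnsures.mono {P : S → A → Set (S → ℝ)} {opt : Opt} {s : S} {Φ Ψ : ℕ × (S → ℝ) → Prop}
    (h : ∀ b, Φ b → Ψ b) (hΦ : M.MinEnsures P opt s Φ) : M.MinEnsures P opt s Ψ := by
  cases opt with
  | min => obtain ⟨a, ha, hp⟩ := hΦ; exact ⟨a, ha, fun p hpP => h _ (hp p hpP)⟩
  | max => exact fun a ha => (hΦ a ha).imp fun p hp => ⟨hp.1, h _ hp.2⟩

theorem maxEnsures_of_not_minEnsures {P : S → A → Set (S → ℝ)} {opt : Opt} {s : S}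
    {Φ : ℕ × (S → ℝ) → Prop} (h : ¬M.MinEnsures P opt s fun b => ¬Φ b) :
    M.MaxEnsures P opt s Φ := by
  cases opt <;> simpa [MinEnsures, MaxEnsures] using h

/-- The distribution with a given vector of probabilities. -/
noncomputable def simplexPMF {p : S → ℝ} (hp : p ∈ stdSimplex ℝ S) : PMF S :=
  PMF.ofFintype (fun s => ENNReal.ofReal (p s)) (by
    rw [← ENNReal.ofReal_sum_of_nonneg fun s _ => hp.1 s, hp.2, ENNReal.ofReal_one])

theorem toReal_simplexPMF {p : S → ℝ} (hp : p ∈ stdSimplex ℝ S) :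
    (fun s => (simplexPMF hp s).toReal) = p :=
  funext fun s => by simp [simplexPMF, ENNReal.toReal_ofReal (hp.1 s)]

open Classical in
/-- The positional environment policy that chooses `p s a`. -/
noncomputable def positionalEnv {p : S → A → S → ℝ}
    (hp : ∀ s a, M.Available s a → p s a ∈ M.unc s a) : M.EnvPolicy where
  choose n h :=
    if ha : M.Available (h (Fin.last n)).1 (h (Fin.last n)).2 then
      simplexPMF (M.unc_subset _ _ (hp _ _ ha))
    else PMF.pure (h (Fin.last n)).1
  choose_mem n h ha := by
    simp only [dif_pos ha, toReal_simplexPMF]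
    exact hp _ _ ha

/-- The positional agent policy that chooses `σ s`. -/
noncomputable def positionalAgent {σ : S → A} (hσ : ∀ s, M.Available s (σ s)) :
    M.AgentPolicy where
  act _ _ s := PMF.pure (σ s)
  act_available n h s a ha := by
    obtain rfl : a = σ s := by simpa using ha
    exact hσ s

theorem consistent_positionalEnv [Fintype A] [MeasurableSpace S] [DiscreteMeasurableSpace S]
    [MeasurableSpace A] [DiscreteMeasurableSpace A] {p : S → A → S → ℝ}
    (hp : ∀ s a, M.Available s a → p s a ∈ M.unc s a) (π : M.AgentPolicy) :
    Consistent π (positionalEnv hp) fun s => {c | ∃ a, M.Available s a ∧ c = (a, p s a)} := by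
  classical
  intro n h s a ha
  have hav := π.act_available n h s a ha
  refine ⟨a, hav, ?_⟩
  have key : ∀ y : S × A, M.Available y.1 y.2 → y = (s, a) →
      (if ha : M.Available y.1 y.2 then simplexPMF (M.unc_subset _ _ (hp _ _ ha))
        else PMF.pure y.1) = simplexPMF (M.unc_subset _ _ (hp s a hav)) := by
    rintro _ h1 rfl
    rw [dif_pos h1]
  congr 1
  have hlast : (Fin.snoc h (s, a) : Fin (n + 1) → S × A) (Fin.last n) = (s, a) :=
    Fin.snoc_last (α := fun _ => S × A) (s, a) h
  simp only [positionalEnv]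
  rw [key _ (by rw [hlast]; exact hav) hlast, toReal_simplexPMF]

theorem consistent_positionalAgent [Fintype A] [MeasurableSpace S] [DiscreteMeasurableSpace S]
    [MeasurableSpace A] [DiscreteMeasurableSpace A] {σ : S → A} (hσ : ∀ s, M.Available s (σ s))
    (τ : M.EnvPolicy) :
    Consistent (positionalAgent hσ) τ fun s => {σ s} ×ˢ M.unc s (σ s) := by
  intro n h s a ha
  obtain rfl : a = σ s := by simpa [positionalAgent] using ha
  refine ⟨rfl, ?_⟩
  have hlast : (Fin.snoc h (s, σ s) : Fin (n + 1) → S × A) (Fin.last n) = (s, σ s) :=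
    Fin.snoc_last (α := fun _ => S × A) (s, σ s) h
  have := τ.choose_mem n (Fin.snoc h (s, σ s)) (by rw [hlast]; exact hσ s)
  rw [hlast] at this
  exact this

variable [Fintype A] [MeasurableSpace S] [DiscreteMeasurableSpace S]
  [MeasurableSpace A] [DiscreteMeasurableSpace A]

theorem value_le {opt : Opt} {v : S → ℝ≥0∞}
    (hv : ∀ s, M.MinEnsures M.unc opt s fun b => b.1 + dot b.2 v ≤ v s) (s : S) :
    M.value opt s ≤ v s := by
  cases opt with
  | min =>
    choose σ hσ hle using hv
    refine iInf_le_of_le (positionalAgent hσ) (iSup_le fun τ => ?_)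
    refine (consistent_positionalAgent hσ τ).policyValue_le ?_ s
    rintro s ⟨a, p⟩ ⟨rfl, hp⟩
    exact hle s p hp
  | max =>
    have h : ∀ s a, ∃ p, M.Available s a → p ∈ M.unc s a ∧ M.reward s a + dot p v ≤ v s :=
      fun s a => by
        by_cases ha : M.Available s a
        · obtain ⟨p, hp⟩ := hv s a ha
          exact ⟨p, fun _ => hp⟩
        · exact ⟨0, fun h => absurd h ha⟩
    choose p hp using h
    refine iSup_le fun π => iInf_le_of_le (positionalEnv fun s a ha => (hp s a ha).1) ?_
    refine (consistent_positionalEnv _ π).policyValue_le ?_ s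
    rintro s _ ⟨a, ha, rfl⟩
    exact (hp s a ha).2

theorem value_eq_top (hcomp : ∀ s a, IsCompact (M.unc s a)) {opt : Opt} {I : Set S} {k d : S → ℕ}
    (hI : ∀ s ∈ I, M.MaxEnsures M.unc opt s (GoodMove moveSupp movePos
      {s' | s' ∈ I ∧ k s' < k s} {s' | s' ∈ I ∧ k s' = k s} {s' | d s' < d s}))
    {s : S} (hs : s ∈ I) : M.value opt s = ⊤ := by
  let _ : TopologicalSpace A := ⊥
  have : DiscreteTopology A := ⟨rfl⟩
  cases opt with
  | min =>
    have h : ∀ s a, ∃ p, M.Available s a → p ∈ M.unc s a ∧ (s ∈ I → GoodMove moveSupp movePos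
        {s' | s' ∈ I ∧ k s' < k s} {s' | s' ∈ I ∧ k s' = k s} {s' | d s' < d s}
        (M.reward s a, p)) := fun s a => by
      by_cases ha : M.Available s a
      · by_cases hs : s ∈ I
        · obtain ⟨p, hp, hg⟩ := hI s hs a ha
          exact ⟨p, fun _ => ⟨hp, fun _ => hg⟩⟩
        · exact ⟨ha.some, fun _ => ⟨ha.some_mem, fun h => absurd h hs⟩⟩
      · exact ⟨0, fun h => absurd h ha⟩
    choose p hp using h
    refine top_unique (le_iInf fun π =>
      le_iSup_of_le (positionalEnv fun s a ha => (hp s a ha).1) (ge_of_eq ?_))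
    refine (consistent_positionalEnv _ π).policyValue_eq_top (fun s => ?_) (fun s _ => ?_)
      (I := I) (k := k) (d := d) ?_ hs
    · obtain ⟨a, ha⟩ := M.exists_available s
      exact ⟨(a, p s a), a, ha, rfl⟩
    · refine Set.Finite.isCompact ((Set.finite_range fun a => (a, p s a)).subset ?_)
      rintro _ ⟨a, _, rfl⟩
      exact ⟨a, rfl⟩
    · rintro s hs _ ⟨a, ha, rfl⟩
      exact ⟨M.unc_subset _ _ (hp s a ha).1, (hp s a ha).2 hs⟩
  | max =>
    have h : ∀ s, ∃ a, M.Available s a ∧ (s ∈ I → ∀ p ∈ M.unc s a, GoodMove moveSupp movePos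
        {s' | s' ∈ I ∧ k s' < k s} {s' | s' ∈ I ∧ k s' = k s} {s' | d s' < d s}
        (M.reward s a, p)) := fun s => by
      by_cases hs : s ∈ I
      · obtain ⟨a, ha, hg⟩ := hI s hs
        exact ⟨a, ha, fun _ => hg⟩
      · obtain ⟨a, ha⟩ := M.exists_available s
        exact ⟨a, ha, fun h => absurd h hs⟩
    choose σ hσ hg using h
    refine top_unique (le_iSup_of_le (positionalAgent hσ) (le_iInf fun τ => ge_of_eq ?_))
    refine (consistent_positionalAgent hσ τ).policyValue_eq_top (fun s => ?_) (fun s _ => ?_)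
      (I := I) (k := k) (d := d) ?_ hs
    · exact (Set.singleton_nonempty _).prod (hσ s)
    · exact isCompact_singleton.prod (hcomp _ _)
    · rintro s hs ⟨_, p⟩ ⟨rfl, hp⟩
      exact ⟨M.unc_subset _ _ hp, hg s hs p hp⟩

end Ensures

end RMDP

/-! ### Optimizing linear functions over a set of distributions -/

section Linear

variable {S : Type} [Fintype S]

/-- A linear function with coefficients in `ℕ`. -/
def lin (c : S → ℕ) (p : S → ℝ) : ℝ := ∑ s, (c s : ℝ) * p s

/-- The optimum of a linear function over a set of distributions. -/
noncomputable def optVal (o : Opt) (P : Set (S → ℝ)) (c : S → ℕ) : ℝ :=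
  match o with
  | .max => sSup (lin c '' P)
  | .min => sInf (lin c '' P)

theorem continuous_lin (c : S → ℕ) : Continuous (lin c) :=
  continuous_finsetSum _ fun s _ => continuous_const.mul (continuous_apply s)

theorem lin_add (c c' : S → ℕ) (p : S → ℝ) : lin (fun s => c s + c' s) p = lin c p + lin c' p := by
  simp [lin, add_mul, Finset.sum_add_distrib]

theorem lin_const (N : ℕ) {p : S → ℝ} (hp : p ∈ stdSimplex ℝ S) : lin (fun _ => N) p = N := by
  simp [lin, ← Finset.mul_sum, hp.2]

theorem lin_congr {c c' : S → ℕ} {p : S → ℝ} (hp : p ∈ stdSimplex ℝ S)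
    (h : ∀ s, 0 < p s → c s = c' s) : lin c p = lin c' p :=
  Finset.sum_congr rfl fun s _ => by
    obtain h0 | h0 := (hp.1 s).eq_or_lt
    · rw [← h0, mul_zero, mul_zero]
    · rw [h s h0]

theorem lin_nonneg (c : S → ℕ) {p : S → ℝ} (hp : p ∈ stdSimplex ℝ S) : 0 ≤ lin c p :=
  Finset.sum_nonneg fun s _ => mul_nonneg (Nat.cast_nonneg _) (hp.1 s)

theorem le_lin (c : S → ℕ) {p : S → ℝ} (hp : p ∈ stdSimplex ℝ S) (s : S) :
    (c s : ℝ) * p s ≤ lin c p :=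
  Finset.single_le_sum (f := fun s => (c s : ℝ) * p s)
    (fun s _ => mul_nonneg (Nat.cast_nonneg _) (hp.1 s)) (Finset.mem_univ s)

theorem lin_mono {c c' : S → ℕ} {p : S → ℝ} (hp : p ∈ stdSimplex ℝ S)
    (h : ∀ s, c s ≤ c' s) : lin c p ≤ lin c' p :=
  Finset.sum_le_sum fun s _ => mul_le_mul_of_nonneg_right (Nat.cast_le.2 (h s)) (hp.1 s)

theorem eq_zero_of_lin_le {c : S → ℕ} {p : S → ℝ} (hp : p ∈ stdSimplex ℝ S) (h : lin c p ≤ 0)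
    {s : S} (hs : 0 < p s) : c s = 0 := by
  by_contra h0
  have h1 : (0 : ℝ) < c s * p s := mul_pos (Nat.cast_pos.2 (Nat.pos_of_ne_zero h0)) hs
  linarith [le_lin c hp s]

theorem exists_pos_of_lin_pos {c : S → ℕ} {p : S → ℝ} (hp : p ∈ stdSimplex ℝ S) (h : 0 < lin c p) :
    ∃ s, 0 < p s ∧ c s ≠ 0 := by
  by_contra! h'
  have h0 := lin_congr hp (c' := fun _ => 0) h'
  rw [h0] at h
  simp [lin] at h

theorem le_of_subset_convexHull {P E : Set (S → ℝ)} (hPE : P ⊆ convexHull ℝ E) {c : S → ℕ} {x : ℝ}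
    (h : ∀ p ∈ E, lin c p ≤ x) {p : S → ℝ} (hp : p ∈ P) : lin c p ≤ x := by
  have hconv : Convex ℝ {p | lin c p ≤ x} := convex_halfSpace_le (f := lin c)
    ⟨fun p q => by simp [lin, mul_add, Finset.sum_add_distrib],
      fun t p => by simp [lin, Finset.mul_sum, mul_left_comm]⟩ x
  exact convexHull_min (fun p hp => h p hp) hconv (hPE hp)

theorem ge_of_subset_convexHull {P E : Set (S → ℝ)} (hPE : P ⊆ convexHull ℝ E) {c : S → ℕ} {x : ℝ}
    (h : ∀ p ∈ E, x ≤ lin c p) {p : S → ℝ} (hp : p ∈ P) : x ≤ lin c p := by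
  have hconv : Convex ℝ {p | x ≤ lin c p} := convex_halfSpace_ge (f := lin c)
    ⟨fun p q => by simp [lin, mul_add, Finset.sum_add_distrib],
      fun t p => by simp [lin, Finset.mul_sum, mul_left_comm]⟩ x
  exact convexHull_min (fun p hp => h p hp) hconv (hPE hp)

variable {P : Set (S → ℝ)}

theorem lin_le_optVal (hP : IsCompact P) (c : S → ℕ) {p : S → ℝ} (hp : p ∈ P) :
    lin c p ≤ optVal .max P c :=
  le_csSup (hP.image (continuous_lin c)).bddAbove ⟨p, hp, rfl⟩

theorem optVal_le_lin (hP : IsCompact P) (c : S → ℕ) {p : S → ℝ} (hp : p ∈ P) :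
    optVal .min P c ≤ lin c p :=
  csInf_le (hP.image (continuous_lin c)).bddBelow ⟨p, hp, rfl⟩

theorem exists_lin_eq_optVal (o : Opt) (hP : IsCompact P) (hne : P.Nonempty) (c : S → ℕ) :
    ∃ p ∈ P, lin c p = optVal o P c := by
  cases o with
  | max => exact (hP.image (continuous_lin c)).sSup_mem (hne.image _)
  | min => exact (hP.image (continuous_lin c)).sInf_mem (hne.image _)

theorem optVal_const (o : Opt) (hP : IsCompact P) (hne : P.Nonempty) (hS : P ⊆ stdSimplex ℝ S)
    (N : ℕ) : optVal o P (fun _ => N) = N := by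
  obtain ⟨p, hp, h⟩ := exists_lin_eq_optVal o hP hne fun _ => N
  rw [← h, lin_const N (hS hp)]

end Linear

/-! ### Conditions on a single state-action pair -/

/-- What a certificate says about a state: whether its value is infinite, and two numbers.  For a
state with finite value, the first number is an upper bound on the value. For a state with infinite
value, the numbers are ranks. -/
abbrev StateInfo : Type := Bool × ℕ × ℕ

/-- A large number, the reward of a state-action pair, and the information about the state. -/
abbrev CellData : Type := ℕ × ℕ × StateInfo

instance : DecidableEq Opt := Opt.equivBool.injective.decidableEq

namespace CellData

/-- The state is declared infinite, with smaller first rank. -/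
abbrev Below (x : CellData) (z : StateInfo) : Prop := z.1 = true ∧ z.2.1 < x.2.2.2.1

/-- The state is declared infinite, with the same first rank. -/
abbrev Same (x : CellData) (z : StateInfo) : Prop := z.1 = true ∧ z.2.1 = x.2.2.2.1

/-- The state has smaller second rank. -/
abbrev Lower (x : CellData) (z : StateInfo) : Prop := z.2.2 < x.2.2.2.2

def zero (_ : CellData) (_ : StateInfo) : ℕ := 0

def one (_ : CellData) (_ : StateInfo) : ℕ := 1

def large (x : CellData) (_ : StateInfo) : ℕ := x.1

def bound (x : CellData) (_ : StateInfo) : ℕ := x.2.2.2.1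

def infinite (_ : CellData) (z : StateInfo) : ℕ := if z.1 = true then 1 else 0

def below (x : CellData) (z : StateInfo) : ℕ := if x.Below z then 1 else 0

def notSame (x : CellData) (z : StateInfo) : ℕ := if x.Same z then 0 else 1

/-- The reward plus the bound on the value of the next state. -/
def cost (x : CellData) (z : StateInfo) : ℕ := (if z.1 = true then x.1 else z.2.1) + x.2.1

def costPenalty (x : CellData) (z : StateInfo) : ℕ := x.cost z + x.infinite z

def gain (x : CellData) (z : StateInfo) : ℕ :=
  if x.Same z then x.1 + ((if x.Lower z then 1 else 0) + x.2.1) else 0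

def gainPenalty (x : CellData) (z : StateInfo) : ℕ := x.gain z + x.notSame z

def stay (x : CellData) (z : StateInfo) : ℕ :=
  (if x.Below z then x.1 else 0) + if x.Below z ∨ x.Same z then 1 else 0

def progress (x : CellData) (z : StateInfo) : ℕ :=
  ((if x.Below z then x.1 else 0) + if x.Lower z then x.1 else 0) + x.2.1

/-- The condition that a certificate has to satisfy at a state-action pair. Here `ask o f g b` means
that `b` is the answer to the question whether the `o`-optimum of `f` is at most that of `g`. -/
def Cell (ask : Opt → (CellData → StateInfo → ℕ) → (CellData → StateInfo → ℕ) → Bool → Prop)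
    (opt : Opt) (x : CellData) : Prop :=
  if x.2.2.1 = true then
    if opt = .min then
      ask .max below zero false ∨ (ask .max gainPenalty gain true ∧ ask .max gain large false)
    else ask .min one stay true ∧ ask .min one progress true
  else
    if opt = .min then ask .max infinite zero true ∧ ask .max cost bound true
    else ask .min costPenalty cost true ∧ ask .min cost bound true

end CellData

section Cell

open CellData

variable {S : Type} [Fintype S]

/-- The true answers for a given uncertainty set. -/
def TrueAnswer (P : Set (S → ℝ)) (z : S → StateInfo) (x : CellData) (o : Opt)
    (f g : CellData → StateInfo → ℕ) (b : Bool) : Prop :=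
  optVal o P (fun s => f x (z s)) ≤ optVal o P (fun s => g x (z s)) ↔ b = true

/-- The bound on the values given by a certificate. -/
noncomputable def infoBound (z : StateInfo) : ℝ≥0∞ := if z.1 = true then ⊤ else z.2.1

theorem infoBound_ne_top {z : StateInfo} (h : z.1 = false) : infoBound z ≠ ⊤ := by
  simp [infoBound, h]

variable {P : Set (S → ℝ)} {z : S → StateInfo} {K r : ℕ} {s : S}

theorem add_dot_infoBound_le {p : S → ℝ} (hp : p ∈ stdSimplex ℝ S)
    (hI : ∀ s', 0 < p s' → (z s').1 = false) (hs : (z s).1 = false)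
    (hle : lin (fun s' => cost (K, r, z s) (z s')) p ≤ (z s).2.1) :
    r + dot p (fun s' => infoBound (z s')) ≤ infoBound (z s) := by
  rw [dot_eq_ofReal hp fun s' h => infoBound_ne_top (hI s' h)]
  have h1 : ∑ s', p s' * (infoBound (z s')).toReal = lin (fun s' => (z s').2.1) p :=
    Finset.sum_congr rfl fun s' _ => by
      obtain h0 | h0 := (hp.1 s').eq_or_lt
      · simp [← h0]
      · simp [infoBound, hI s' h0, mul_comm]
  have h2 : lin (fun s' => cost (K, r, z s) (z s')) p = lin (fun s' => (z s').2.1) p + r := by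
    rw [← lin_const r hp, ← lin_add]
    exact lin_congr hp fun s' h => by simp [cost, hI s' h]
  rw [h1, infoBound, if_neg (by simp [hs]), ← ENNReal.ofReal_natCast r,
    ← ENNReal.ofReal_add (Nat.cast_nonneg r) (lin_nonneg _ hp), ← ENNReal.ofReal_natCast]
  exact ENNReal.ofReal_le_ofReal (by linarith)

theorem Cell.forall_le (hP : IsCompact P) (hne : P.Nonempty) (hS : P ⊆ stdSimplex ℝ S)
    (hs : (z s).1 = false) (h : Cell (TrueAnswer P z (K, r, z s)) .min (K, r, z s)) :
    ∀ p ∈ P, r + dot p (fun s' => infoBound (z s')) ≤ infoBound (z s) := by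
  simp only [Cell, hs, TrueAnswer, Bool.false_eq_true, if_false, if_true, iff_true] at h
  intro p hp
  have h1 := (lin_le_optVal hP _ hp).trans h.1
  have h2 := (lin_le_optVal hP _ hp).trans h.2
  simp only [zero, bound, optVal_const _ hP hne hS] at h1 h2
  refine add_dot_infoBound_le (hS hp) (fun s' h0 => ?_) hs h2
  have := eq_zero_of_lin_le (hS hp) (by exact_mod_cast h1) h0
  simpa [infinite] using this

theorem Cell.exists_le (hP : IsCompact P) (hne : P.Nonempty) (hS : P ⊆ stdSimplex ℝ S)
    (hs : (z s).1 = false) (h : Cell (TrueAnswer P z (K, r, z s)) .max (K, r, z s)) :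
    ∃ p ∈ P, r + dot p (fun s' => infoBound (z s')) ≤ infoBound (z s) := by
  simp only [Cell, hs, TrueAnswer, Bool.false_eq_true, reduceCtorEq, if_false, iff_true] at h
  obtain ⟨p, hp, heq⟩ := exists_lin_eq_optVal .min hP hne
    fun s' => costPenalty (K, r, z s) (z s')
  have h1 := optVal_le_lin hP (fun s' => cost (K, r, z s) (z s')) hp
  have h3 := h.2
  simp only [bound, optVal_const _ hP hne hS] at h3
  have h4 : lin (fun s' => costPenalty (K, r, z s) (z s')) p =
    lin (fun s' => cost (K, r, z s) (z s')) p +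
      lin (fun s' => infinite (K, r, z s) (z s')) p := lin_add _ _ p
  have h5 := lin_nonneg (fun s' => infinite (K, r, z s) (z s')) (hS hp)
  have h6 := h.1
  refine ⟨p, hp, add_dot_infoBound_le (K := K) (hS hp) (fun s' h0 => ?_) hs (by linarith)⟩
  have := eq_zero_of_lin_le (hS hp) (show lin (fun s' => infinite (K, r, z s) (z s')) p ≤ 0 by
    linarith) h0
  simpa [infinite] using this

/-- `GoodMove` for the ranks given by a certificate. -/
def GoodInfo (z : S → StateInfo) (s : S) : ℕ × (S → ℝ) → Prop :=
  GoodMove RMDP.moveSupp RMDP.movePos {s' | (z s').1 = true ∧ (z s').2.1 < (z s).2.1}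
    {s' | (z s').1 = true ∧ (z s').2.1 = (z s).2.1} {s' | (z s').2.2 < (z s).2.2}

theorem Cell.exists_good (hP : IsCompact P) (hne : P.Nonempty) (hS : P ⊆ stdSimplex ℝ S)
    (hs : (z s).1 = true) (h : Cell (TrueAnswer P z (K, r, z s)) .min (K, r, z s)) :
    ∃ p ∈ P, GoodInfo z s (r, p) := by
  simp only [Cell, hs, TrueAnswer, Bool.false_eq_true, if_true, iff_true, iff_false, not_le] at h
  obtain h | ⟨h1, h2⟩ := h
  · obtain ⟨p, hp, heq⟩ := exists_lin_eq_optVal .max hP hne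
      fun s' => below (K, r, z s) (z s')
    simp only [zero, optVal_const _ hP hne hS] at h
    obtain ⟨s', h0, hne⟩ := exists_pos_of_lin_pos (hS hp) (by rw [heq]; exact_mod_cast h)
    exact ⟨p, hp, Or.inl ⟨s', h0, by simpa [below, Below] using hne⟩⟩
  · obtain ⟨p, hp, heq⟩ := exists_lin_eq_optVal .max hP hne fun s' => gain (K, r, z s) (z s')
    simp only [large, optVal_const _ hP hne hS] at h2
    have h3 : lin (fun s' => gainPenalty (K, r, z s) (z s')) p =
      lin (fun s' => gain (K, r, z s) (z s')) p +
        lin (fun s' => notSame (K, r, z s) (z s')) p := lin_add _ _ p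
    have h4 := lin_le_optVal hP (fun s' => gainPenalty (K, r, z s) (z s')) hp
    have hB : ∀ s', 0 < p s' → (z s').1 = true ∧ (z s').2.1 = (z s).2.1 := fun s' h0 => by
      have := eq_zero_of_lin_le (hS hp) (show lin (fun s' => notSame (K, r, z s) (z s')) p ≤ 0 by
        linarith) h0
      simpa [notSame, Same] using this
    refine ⟨p, hp, Or.inr ⟨hB, ?_⟩⟩
    by_contra! hno
    have hr : r = 0 := Nat.eq_zero_of_not_pos hno.1
    have : lin (fun s' => gain (K, r, z s) (z s')) p = K := by
      rw [← lin_const K (hS hp)]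
      refine lin_congr (hS hp) fun s' h0 => ?_
      have := hno.2 s' h0
      simp only [Set.mem_ofPred_eq] at this
      simp [gain, Same, Lower, hB s' h0, hr, this]
    linarith

theorem Cell.forall_good (hP : IsCompact P) (hne : P.Nonempty) (hS : P ⊆ stdSimplex ℝ S)
    (hs : (z s).1 = true) (h : Cell (TrueAnswer P z (K, r, z s)) .max (K, r, z s)) :
    ∀ p ∈ P, GoodInfo z s (r, p) := by
  simp only [Cell, hs, TrueAnswer, reduceCtorEq, if_false, if_true, iff_true] at h
  intro p hp
  have h1 := h.1.trans (optVal_le_lin hP _ hp)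
  have h2 := h.2.trans (optVal_le_lin hP _ hp)
  simp only [one, optVal_const _ hP hne hS, Nat.cast_one] at h1 h2
  by_cases hI : ∃ s', 0 < p s' ∧ (z s').1 = true ∧ (z s').2.1 < (z s).2.1
  · exact Or.inl hI
  push Not at hI
  have hB : ∀ s', 0 < p s' → (z s').1 = true ∧ (z s').2.1 = (z s).2.1 := by
    have h3 : lin (fun s' => stay (K, r, z s) (z s')) p +
        lin (fun s' => notSame (K, r, z s) (z s')) p = 1 := by
      rw [← lin_add, ← Nat.cast_one (R := ℝ), ← lin_const 1 (hS hp)]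
      refine lin_congr (hS hp) fun s' h0 => ?_
      have : ¬Below (K, r, z s) (z s') := fun hb => absurd hb.2 (not_lt.2 (hI s' h0 hb.1))
      simp only [stay, notSame, this, false_or, if_false]
      by_cases hsame : Same (K, r, z s) (z s')
      · rw [if_pos hsame, if_pos hsame]
      · rw [if_neg hsame, if_neg hsame]
    intro s' h0
    have := eq_zero_of_lin_le (hS hp) (show lin (fun s' => notSame (K, r, z s) (z s')) p ≤ 0 by
        linarith) h0
    simpa [notSame, Same] using this
  refine Or.inr ⟨hB, ?_⟩
  by_contra! hno
  have hr : r = 0 := Nat.eq_zero_of_not_pos hno.1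
  have : lin (fun s' => progress (K, r, z s) (z s')) p = (0 : ℕ) := by
    rw [← lin_const 0 (hS hp)]
    refine lin_congr (hS hp) fun s' h0 => ?_
    have h4 := hno.2 s' h0
    simp only [Set.mem_ofPred_eq] at h4
    have h5 := (hB s' h0).2
    simp [progress, Below, Lower, h4, h5, hr]
  simp only [Nat.cast_zero] at this
  linarith

end Cell

/-! ### Existence of certificates -/

section Complete

open CellData

variable {S : Type} [Fintype S] {P E : Set (S → ℝ)} {z : S → StateInfo} {K q r : ℕ} {s : S}

/-- All probabilities of the distributions in `E` are `0` or at least `1 / q`. -/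
def HasGap (q : ℕ) (E : Set (S → ℝ)) : Prop := ∀ p ∈ E, ∀ s, 0 < p s → 1 ≤ q * p s

/-- The bounds given by `z` are compatible with a move. -/
def SafeInfo (z : S → StateInfo) (s : S) (b : ℕ × (S → ℝ)) : Prop :=
  (∀ s', 0 < b.2 s' → (z s').1 = false) ∧ lin (fun s' => (z s').2.1) b.2 + b.1 ≤ (z s).2.1

theorem SafeInfo.lin_cost_le {p : S → ℝ} (hp : p ∈ stdSimplex ℝ S) (h : SafeInfo z s (r, p)) :
    lin (fun s' => cost (K, r, z s) (z s')) p ≤ (z s).2.1 := by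
  refine le_trans (le_of_eq ?_) h.2
  rw [← lin_const r hp, ← lin_add]
  exact lin_congr hp fun s' h0 => by simp [cost, h.1 s' h0]

theorem cell_of_forall_safe (hP : IsCompact P) (hne : P.Nonempty) (hS : P ⊆ stdSimplex ℝ S)
    (hE : E ⊆ P) (hPE : P ⊆ convexHull ℝ E) (hs : (z s).1 = false)
    (h : ∀ p ∈ E, SafeInfo z s (r, p)) :
    Cell (TrueAnswer P z (K, r, z s)) .min (K, r, z s) := by
  simp only [Cell, hs, TrueAnswer, Bool.false_eq_true, if_false, if_true, iff_true]
  simp only [zero, bound, optVal_const _ hP hne hS]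
  constructor
  · obtain ⟨p, hp, heq⟩ := exists_lin_eq_optVal .max hP hne fun s' => infinite (K, r, z s) (z s')
    rw [← heq]
    refine le_of_subset_convexHull hPE (fun p hp => le_of_eq ?_) hp
    rw [← lin_const 0 (hS (hE hp))]
    exact lin_congr (hS (hE hp)) fun s' h0 => by simp [infinite, (h p hp).1 s' h0]
  · obtain ⟨p, hp, heq⟩ := exists_lin_eq_optVal .max hP hne fun s' => cost (K, r, z s) (z s')
    rw [← heq]
    exact le_of_subset_convexHull hPE (fun p hp => (h p hp).lin_cost_le (hS (hE hp))) hp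

theorem cell_of_exists_safe (hP : IsCompact P) (hne : P.Nonempty) (hS : P ⊆ stdSimplex ℝ S)
    (hE : E ⊆ P) (hPE : P ⊆ convexHull ℝ E) (hs : (z s).1 = false) (hq : HasGap q E)
    (hK : q * (z s).2.1 ≤ K) (h : ∃ p ∈ E, SafeInfo z s (r, p)) :
    Cell (TrueAnswer P z (K, r, z s)) .max (K, r, z s) := by
  simp only [Cell, hs, TrueAnswer, Bool.false_eq_true, reduceCtorEq, if_false, iff_true]
  simp only [bound, optVal_const _ hP hne hS]
  obtain ⟨p₀, hp₀, hsafe⟩ := h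
  have hcost := hsafe.lin_cost_le (K := K) (hS (hE hp₀))
  have hpen : ∀ p ∈ P, (∀ s', 0 < p s' → (z s').1 = false) →
      optVal .min P (fun s' => costPenalty (K, r, z s) (z s')) ≤
        lin (fun s' => cost (K, r, z s) (z s')) p := fun p hp h0 => by
    refine (optVal_le_lin hP _ hp).trans (le_of_eq (lin_congr (hS hp) fun s' h => ?_))
    simp [costPenalty, infinite, h0 s' h]
  constructor
  · obtain ⟨p, hp, heq⟩ := exists_lin_eq_optVal .min hP hne fun s' => cost (K, r, z s) (z s')
    rw [← heq]
    refine ge_of_subset_convexHull hPE (fun p hp => ?_) hp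
    by_cases h0 : ∀ s', 0 < p s' → (z s').1 = false
    · exact hpen p (hE hp) h0
    · push Not at h0
      obtain ⟨s', h0, hinf⟩ := h0
      refine (hpen p₀ (hE hp₀) hsafe.1).trans (hcost.trans ?_)
      refine le_trans ?_ (le_lin _ (hS (hE hp)) s')
      have h1 := hq p hp s' h0
      have h2 : ((q * (z s).2.1 : ℕ) : ℝ) ≤ (cost (K, r, z s) (z s') : ℕ) :=
        Nat.cast_le.2 (hK.trans (by simp [cost, hinf]))
      push_cast at h2
      nlinarith [mul_le_mul_of_nonneg_right h2 h0.le,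
        mul_le_mul_of_nonneg_right h1 (Nat.cast_nonneg (α := ℝ) (z s).2.1)]
  · exact (optVal_le_lin hP _ (hE hp₀)).trans hcost

theorem cell_of_exists_good (hP : IsCompact P) (hne : P.Nonempty) (hS : P ⊆ stdSimplex ℝ S)
    (hE : E ⊆ P) (hPE : P ⊆ convexHull ℝ E) (hs : (z s).1 = true) (hq : HasGap q E)
    (hK : q * (1 + r) ≤ K) (h : ∃ p ∈ E, GoodInfo z s (r, p)) :
    Cell (TrueAnswer P z (K, r, z s)) .min (K, r, z s) := by
  simp only [Cell, hs, TrueAnswer, Bool.false_eq_true, if_true, iff_true, iff_false, not_le]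
  simp only [zero, large, optVal_const _ hP hne hS]
  obtain ⟨p₀, hp₀, hgood⟩ := h
  obtain ⟨s', h0, hI⟩ | ⟨hB, hprog⟩ := hgood
  · refine Or.inl (lt_of_lt_of_le ?_ (lin_le_optVal hP _ (hE hp₀)))
    refine lt_of_lt_of_le ?_ (le_lin _ (hS (hE hp₀)) s')
    have : below (K, r, z s) (z s') = 1 := if_pos hI
    rw [this, Nat.cast_one, one_mul, Nat.cast_zero]
    exact h0
  · refine Or.inr ⟨?_, ?_⟩
    · obtain ⟨p, hp, heq⟩ := exists_lin_eq_optVal .max hP hne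
        fun s' => gainPenalty (K, r, z s) (z s')
      rw [← heq]
      refine le_of_subset_convexHull hPE (fun p hp => ?_) hp
      by_cases hsame : ∀ s', 0 < p s' → Same (K, r, z s) (z s')
      · refine le_trans (le_of_eq (lin_congr (hS (hE hp)) fun s' h0 => ?_))
          (lin_le_optVal hP _ (hE hp))
        rw [gainPenalty, notSame, if_pos (hsame s' h0), add_zero]
      · push Not at hsame
        obtain ⟨s', h0, hns⟩ := hsame
        have hK₀ : (K : ℝ) ≤ optVal .max P fun s' => gain (K, r, z s) (z s') := by
          refine le_trans ?_ (lin_le_optVal hP _ (hE hp₀))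
          have hgain : lin (fun s' => gain (K, r, z s) (z s')) p₀ = lin (fun s' =>
              K + ((if Lower (K, r, z s) (z s') then 1 else 0) + r)) p₀ :=
            lin_congr (hS (hE hp₀)) fun s' h0 => if_pos (hB s' h0)
          rw [← lin_const K (hS (hE hp₀)), hgain]
          exact lin_mono (hS (hE hp₀)) fun s' => Nat.le_add_right _ _
        refine le_trans ?_ hK₀
        let c : S → ℕ := fun t => if Same (K, r, z s) (z t) then 0 else K + r
        have h1 : lin (fun t => gainPenalty (K, r, z s) (z t)) p + lin c p ≤ K + 1 + r := by
          have : ((K : ℝ) + 1 + r) = ((K + 1 + r : ℕ) : ℝ) := by push_cast; ring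
          rw [this, ← lin_const (K + 1 + r) (hS (hE hp)), ← lin_add]
          refine lin_mono (hS (hE hp)) fun t => ?_
          by_cases ht : Same (K, r, z s) (z t)
          · simp only [gainPenalty, gain, notSame, c]
            rw [if_pos ht, if_pos ht, if_pos ht]
            split_ifs <;> omega
          · simp only [gainPenalty, gain, notSame, c]
            rw [if_neg ht, if_neg ht, if_neg ht]
            omega
        have h2 := le_lin c (hS (hE hp)) s'
        have h3 : c s' = K + r := if_neg hns
        rw [h3] at h2
        have h4 := hq p hp s' h0
        have h5 : ((q * (1 + r) : ℕ) : ℝ) ≤ (K + r : ℕ) := Nat.cast_le.2 (by omega)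
        have h6 := mul_le_mul_of_nonneg_right h5 h0.le
        have h7 := mul_le_mul_of_nonneg_right h4 (show (0 : ℝ) ≤ 1 + r by positivity)
        push_cast at h6 h2
        nlinarith
    · refine lt_of_lt_of_le ?_ (lin_le_optVal hP _ (hE hp₀))
      have h1 : lin (fun s' => gain (K, r, z s) (z s')) p₀ =
          lin (fun s' => (if Lower (K, r, z s) (z s') then 1 else 0) + r) p₀ + K := by
        rw [← lin_const K (hS (hE hp₀)), ← lin_add]
        exact lin_congr (hS (hE hp₀)) fun s' h0 => (if_pos (hB s' h0)).trans (add_comm _ _)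
      rw [h1]
      suffices 0 < lin (fun s' => (if Lower (K, r, z s) (z s') then 1 else 0) + r) p₀ by linarith
      obtain hr | ⟨s', h0, hlow⟩ := hprog
      · refine lt_of_lt_of_le (b := (r : ℝ)) (Nat.cast_pos.2 hr) ?_
        rw [← lin_const r (hS (hE hp₀))]
        exact lin_mono (hS (hE hp₀)) fun s' => Nat.le_add_left _ _
      · refine lt_of_lt_of_le (mul_pos ?_ h0) (le_lin _ (hS (hE hp₀)) s')
        rw [if_pos (show Lower (K, r, z s) (z s') from hlow)]
        exact Nat.cast_pos.2 (by omega)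

theorem cell_of_forall_good (hP : IsCompact P) (hne : P.Nonempty) (hS : P ⊆ stdSimplex ℝ S)
    (hE : E ⊆ P) (hPE : P ⊆ convexHull ℝ E) (hs : (z s).1 = true) (hq : HasGap q E)
    (hK : q ≤ K) (h : ∀ p ∈ E, GoodInfo z s (r, p)) :
    Cell (TrueAnswer P z (K, r, z s)) .max (K, r, z s) := by
  simp only [Cell, hs, TrueAnswer, reduceCtorEq, if_false, if_true, iff_true]
  simp only [one, optVal_const _ hP hne hS, Nat.cast_one]
  have key : ∀ (p : S → ℝ) (c : S → ℕ) (s' : S), p ∈ E → 0 < p s' → K ≤ c s' → 1 ≤ lin c p :=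
    fun p c s' hp h0 hc => by
      refine le_trans (hq p hp s' h0) (le_trans ?_ (le_lin c (hS (hE hp)) s'))
      exact mul_le_mul_of_nonneg_right (Nat.cast_le.2 (hK.trans hc)) h0.le
  constructor
  · obtain ⟨p, hp, heq⟩ := exists_lin_eq_optVal .min hP hne fun s' => stay (K, r, z s) (z s')
    rw [← heq]
    refine ge_of_subset_convexHull hPE (fun p hp => ?_) hp
    obtain ⟨s', h0, hI⟩ | ⟨hB, -⟩ := h p hp
    · refine key p _ s' hp h0 ?_
      rw [stay, if_pos (show Below (K, r, z s) (z s') from hI)]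
      exact Nat.le_add_right _ _
    · have hstay : lin (fun s' => stay (K, r, z s) (z s')) p =
          lin (fun s' => (if Below (K, r, z s) (z s') then K else 0) + 1) p :=
        lin_congr (hS (hE hp)) fun s' h0 => congrArg _ (if_pos (Or.inr (hB s' h0)))
      rw [← Nat.cast_one (R := ℝ), ← lin_const 1 (hS (hE hp)), hstay]
      exact lin_mono (hS (hE hp)) fun s' => Nat.le_add_left _ _
  · obtain ⟨p, hp, heq⟩ := exists_lin_eq_optVal .min hP hne fun s' => progress (K, r, z s) (z s')
    rw [← heq]
    refine ge_of_subset_convexHull hPE (fun p hp => ?_) hp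
    obtain ⟨s', h0, hI⟩ | ⟨-, hr | ⟨s', h0, hlow⟩⟩ := h p hp
    · refine key p _ s' hp h0 ?_
      rw [progress, if_pos (show Below (K, r, z s) (z s') from hI), add_assoc]
      exact Nat.le_add_right _ _
    · rw [← Nat.cast_one (R := ℝ), ← lin_const 1 (hS (hE hp))]
      exact lin_mono (hS (hE hp)) fun s' => le_trans hr (Nat.le_add_left _ _)
    · refine key p _ s' hp h0 ?_
      rw [progress, if_pos (show Lower (K, r, z s) (z s') from hlow)]
      change K ≤ _ + K + r
      omega

/-- Bounds on the values that are obtained from ranks `ρ ≤ N`. -/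
def rankBound (R b N : ℕ) (j : ℕ) : ℕ := R * (b ^ (N + 1) - b ^ (N - j))

theorem lin_rankBound_add_le {R N : ℕ} {I : Set S} {ρ : S → ℕ} {p : S → ℝ}
    (hp : p ∈ stdSimplex ℝ S) (hρ : ∀ s, ρ s ≤ N) (hgap : ∀ s, 0 < p s → 1 ≤ q * p s) (hr : r ≤ R)
    (h : SafeMove RMDP.moveSupp RMDP.movePos I {s' | s' ∉ I ∧ ρ s' < ρ s}
        {s' | s' ∉ I ∧ ρ s' = ρ s} (r, p)) :
    lin (fun s' => rankBound R (2 * q) N (ρ s')) p + r ≤ rankBound R (2 * q) N (ρ s) := by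
  obtain ⟨-, ⟨s', h0, -, hlt⟩ | ⟨hr0, hsame⟩⟩ := h
  · have hq0 : 0 < q := by
      rcases Nat.eq_zero_or_pos q with rfl | h
      · have := hgap s' h0
        norm_num at this
      · exact h
    have hcast : ∀ j, (rankBound R (2 * q) N j : ℝ) + R * (2 * q) ^ (N - j) =
        R * (2 * q) ^ (N + 1) := fun j => by
      rw [rankBound, Nat.cast_mul, Nat.cast_sub (Nat.pow_le_pow_right (by omega) (by omega))]
      push_cast
      ring
    have h1 : lin (fun s' => rankBound R (2 * q) N (ρ s')) p +
        lin (fun s' => R * (2 * q) ^ (N - ρ s')) p = R * (2 * q) ^ (N + 1) := by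
      have : (R * (2 * q) ^ (N + 1) : ℝ) = ((R * (2 * q) ^ (N + 1) : ℕ) : ℝ) := by push_cast; rfl
      rw [← lin_add, this, ← lin_const _ hp]
      congr 1
      funext t
      exact_mod_cast hcast (ρ t)
    have h2 := le_lin (fun s' => R * (2 * q) ^ (N - ρ s')) hp s'
    have h3 := hcast (ρ s)
    have h4 : R * (2 * q) ^ (N - ρ s + 1) ≤ R * (2 * q) ^ (N - ρ s') :=
      Nat.mul_le_mul_left _ (Nat.pow_le_pow_right (by omega) (by have := hρ s; omega))
    have h5 : (R : ℝ) * (2 * q) ^ (N - ρ s) * (2 * q) ≤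
        ((R * (2 * q) ^ (N - ρ s') : ℕ) : ℝ) := by
      refine le_trans (le_of_eq ?_) (Nat.cast_le.2 h4)
      push_cast
      ring
    have h6 : (r : ℝ) ≤ R * (2 * q) ^ (N - ρ s) := by
      have : r ≤ R * (2 * q) ^ (N - ρ s) :=
        hr.trans (Nat.le_mul_of_pos_right _ (pow_pos (by omega) _))
      exact_mod_cast this
    have h7 : (0 : ℝ) ≤ R * (2 * q) ^ (N - ρ s) := by positivity
    have h8 := mul_le_mul_of_nonneg_left (hgap s' h0) h7
    have h9 := mul_le_mul_of_nonneg_right h5 h0.le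
    nlinarith
  · have hr0 : r = 0 := Nat.eq_zero_of_not_pos hr0
    rw [hr0, Nat.cast_zero, add_zero, lin_congr hp (c' := fun _ => rankBound R (2 * q) N (ρ s))
      fun s' h0 => by rw [(hsame s' h0).2], lin_const _ hp]

end Complete

/-! ### Soundness and completeness of certificates -/

namespace RMDP

open CellData

variable {S A : Type} [Fintype S] {M : RMDP S A}

/-- The certificate `(K, z)` is correct at the state `s`. -/
def CertifiedAt (M : RMDP S A) (opt : Opt) (K : ℕ) (z : S → StateInfo) (s : S) : Prop :=
  if (z s).1 = true ↔ opt = .max then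
    ∃ a, M.Available s a ∧ Cell (TrueAnswer (M.unc s a) z (K, M.reward s a, z s)) opt
      (K, M.reward s a, z s)
  else ∀ a, M.Available s a → Cell (TrueAnswer (M.unc s a) z (K, M.reward s a, z s)) opt
      (K, M.reward s a, z s)

theorem CertifiedAt.minEnsures (hcomp : ∀ s a, IsCompact (M.unc s a)) {opt : Opt} {K : ℕ}
    {z : S → StateInfo} {s : S} (h : M.CertifiedAt opt K z s) (hs : (z s).1 = false) :
    M.MinEnsures M.unc opt s fun b =>
      b.1 + dot b.2 (fun s' => infoBound (z s')) ≤ infoBound (z s) := by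
  cases opt with
  | min =>
    rw [CertifiedAt, if_pos (by simp [hs])] at h
    obtain ⟨a, ha, hcell⟩ := h
    exact ⟨a, ha, Cell.forall_le (hcomp s a) ha (M.unc_subset s a) hs hcell⟩
  | max =>
    rw [CertifiedAt, if_neg (by simp [hs])] at h
    exact fun a ha => Cell.exists_le (hcomp s a) ha (M.unc_subset s a) hs (h a ha)

theorem CertifiedAt.maxEnsures (hcomp : ∀ s a, IsCompact (M.unc s a)) {opt : Opt} {K : ℕ}
    {z : S → StateInfo} {s : S} (h : M.CertifiedAt opt K z s) (hs : (z s).1 = true) :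
    M.MaxEnsures M.unc opt s (GoodInfo z s) := by
  cases opt with
  | min =>
    rw [CertifiedAt, if_neg (by simp [hs])] at h
    exact fun a ha => Cell.exists_good (hcomp s a) ha (M.unc_subset s a) hs (h a ha)
  | max =>
    rw [CertifiedAt, if_pos (by simp [hs])] at h
    obtain ⟨a, ha, hcell⟩ := h
    exact ⟨a, ha, Cell.forall_good (hcomp s a) ha (M.unc_subset s a) hs hcell⟩

section Value

variable [Fintype A] [MeasurableSpace S] [DiscreteMeasurableSpace S]
  [MeasurableSpace A] [DiscreteMeasurableSpace A]

theorem value_eq_top_of_certified (hcomp : ∀ s a, IsCompact (M.unc s a)) {opt : Opt} {K : ℕ}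
    {z : S → StateInfo} (h : ∀ s, M.CertifiedAt opt K z s) {s : S} (hs : (z s).1 = true) :
    M.value opt s = ⊤ :=
  value_eq_top hcomp (I := {s | (z s).1 = true}) (k := fun s => (z s).2.1)
    (d := fun s => (z s).2.2) (fun s hs => (h s).maxEnsures hcomp hs) hs

theorem value_le_of_certified (hcomp : ∀ s a, IsCompact (M.unc s a)) {opt : Opt} {K : ℕ}
    {z : S → StateInfo} (h : ∀ s, M.CertifiedAt opt K z s) {s : S} (hs : (z s).1 = false) :
    M.value opt s ≤ (z s).2.1 := by
  refine (value_le (v := fun s => infoBound (z s)) (fun s => ?_) s).trans (by simp [infoBound, hs])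
  by_cases hs : (z s).1 = true
  · have htop : infoBound (z s) = ⊤ := if_pos hs
    cases opt with
    | min =>
      obtain ⟨a, ha⟩ := M.exists_available s
      exact ⟨a, ha, fun p _ => by rw [htop]; exact le_top⟩
    | max => exact fun a ha => ⟨ha.some, ha.some_mem, by rw [htop]; exact le_top⟩
  · exact (h s).minEnsures hcomp (by simpa using hs)

end Value

/-- A family of properties of natural numbers that hold from some number on has a common bound. -/
theorem exists_forall_of_monotone {ι : Type*} [Finite ι] {p : ι → ℕ → Prop}
    (hmono : ∀ i m n, m ≤ n → p i m → p i n) (h : ∀ i, ∃ n, p i n) : ∃ n, ∀ i, p i n := by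
  choose f hf using h
  obtain ⟨N, hN⟩ := (Set.finite_range f).bddAbove
  exact ⟨N, fun i => hmono i _ _ (hN ⟨i, rfl⟩) (hf i)⟩

theorem exists_one_le_mul {x : ℝ} (hx : 0 < x) : ∃ q : ℕ, 1 ≤ q * x := by
  obtain ⟨q, hq⟩ := exists_nat_ge (1 / x)
  exact ⟨q, (div_le_iff₀ hx).1 hq⟩

/-- Every uncertainty set is spanned by a set of distributions whose positive probabilities are
bounded from below. -/
theorem exists_hasGap [Finite A] (hcomp : ∀ s a, IsCompact (M.unc s a))
    (h : M.IsPolytopic ∨ M.IsClosed ∧ M.ConstantSupport) :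
    ∃ (E : S → A → Set (S → ℝ)) (q : ℕ), ∀ s a,
      E s a ⊆ M.unc s a ∧ M.unc s a ⊆ convexHull ℝ (E s a) ∧ HasGap q (E s a) := by
  suffices H : ∃ E : S → A → Set (S → ℝ), (∀ s a, E s a ⊆ M.unc s a ∧
      M.unc s a ⊆ convexHull ℝ (E s a)) ∧
      ∀ s a s', ∃ q : ℕ, ∀ p ∈ E s a, 0 < p s' → 1 ≤ q * p s' by
    obtain ⟨E, hE, hq⟩ := H
    obtain ⟨q, hq⟩ := exists_forall_of_monotone (ι := S × A × S)
      (p := fun i q => ∀ p ∈ E i.1 i.2.1, 0 < p i.2.2 → 1 ≤ q * p i.2.2)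
      (fun i m n hmn hm p hp h0 => (hm p hp h0).trans
        (mul_le_mul_of_nonneg_right (Nat.cast_le.2 hmn) h0.le)) fun i => hq i.1 i.2.1 i.2.2
    exact ⟨E, q, fun s a => ⟨(hE s a).1, (hE s a).2, fun p hp s' => hq (s, a, s') p hp⟩⟩
  obtain h | ⟨-, h⟩ := h
  · choose V hV hunc using h
    refine ⟨V, fun s a => ⟨hunc s a ▸ subset_convexHull ℝ _, (hunc s a).le⟩, fun s a s' => ?_⟩
    have := (hV s a).to_subtype
    obtain ⟨q, hq⟩ := exists_forall_of_monotone (ι := V s a)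
      (p := fun v q => 0 < v.1 s' → 1 ≤ q * v.1 s')
      (fun i m n hmn hm h0 => (hm h0).trans
        (mul_le_mul_of_nonneg_right (Nat.cast_le.2 hmn) h0.le)) fun v => by
        by_cases h0 : 0 < v.1 s'
        · exact (exists_one_le_mul h0).imp fun q hq _ => hq
        · exact ⟨0, fun h => absurd h h0⟩
    exact ⟨q, fun p hp => hq ⟨p, hp⟩⟩
  · refine ⟨M.unc, fun s a => ⟨subset_rfl, subset_convexHull ℝ _⟩, fun s a s' => ?_⟩
    by_cases hne : ∃ p ∈ M.unc s a, 0 < p s'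
    · obtain ⟨p, hp, h0⟩ := hne
      obtain ⟨p₀, hp₀, hmin⟩ := (hcomp s a).exists_isMinOn ⟨p, hp⟩
        (continuous_apply s').continuousOn
      have hpos : 0 < p₀ s' := by
        have := h s a p hp p₀ hp₀
        exact (Set.ext_iff.1 this s').1 h0
      obtain ⟨q, hq⟩ := exists_one_le_mul hpos
      exact ⟨q, fun p hp _ => hq.trans
        (mul_le_mul_of_nonneg_left (hmin hp) (Nat.cast_nonneg q))⟩
    · push Not at hne
      exact ⟨0, fun p hp h0 => absurd h0 (not_lt.2 (hne p hp))⟩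

theorem isCompact_unc (h : M.IsPolytopic ∨ M.IsClosed ∧ M.ConstantSupport) (s : S) (a : A) :
    IsCompact (M.unc s a) := by
  obtain h | ⟨h, -⟩ := h
  · obtain ⟨V, hV, hunc⟩ := h s a
    rw [hunc]
    exact hV.isCompact_convexHull ℝ
  · exact (isCompact_stdSimplex ℝ S).of_isClosed_subset (h s a) (M.unc_subset s a)

theorem exists_certified [Finite A] (h : M.IsPolytopic ∨ M.IsClosed ∧ M.ConstantSupport)
    (opt : Opt) : ∃ (K : ℕ) (z : S → StateInfo), ∀ s, M.CertifiedAt opt K z s := by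
  classical
  have hcomp := isCompact_unc h
  obtain ⟨E, q, hE⟩ := exists_hasGap hcomp h
  obtain ⟨I, k, d, ρ, hI, hF⟩ := exists_good_safe_partition (S := S) moveSupp movePos
    (M.MinEnsures E opt) fun s Φ Ψ h hΦ => hΦ.mono h
  obtain ⟨N, hN⟩ : ∃ N, ∀ s, ρ s ≤ N :=
    exists_forall_of_monotone (fun _ _ _ h h' => le_trans h' h) fun s => ⟨ρ s, le_rfl⟩
  obtain ⟨R, hR⟩ : ∃ R, ∀ i : S × A, M.reward i.1 i.2 ≤ R :=
    exists_forall_of_monotone (fun _ _ _ h h' => le_trans h' h) fun i => ⟨_, le_rfl⟩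
  let z : S → StateInfo := fun s =>
    if s ∈ I then (true, k s, d s) else (false, rankBound R (2 * q) N (ρ s), 0)
  have hzI : ∀ s, s ∈ I → z s = (true, k s, d s) := fun s hs => if_pos hs
  have hzF : ∀ s, s ∉ I → z s = (false, rankBound R (2 * q) N (ρ s), 0) := fun s hs => if_neg hs
  obtain ⟨K₁, hK₁⟩ : ∃ K, ∀ s, q * (z s).2.1 ≤ K :=
    exists_forall_of_monotone (fun _ _ _ h h' => le_trans h' h) fun s => ⟨_, le_rfl⟩
  let K := K₁ + q * (1 + R)
  have hKv : ∀ s, q * (z s).2.1 ≤ K := fun s => (hK₁ s).trans (Nat.le_add_right _ _)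
  have hKr : ∀ s a, q * (1 + M.reward s a) ≤ K := fun s a =>
    (Nat.mul_le_mul_left q (Nat.add_le_add_left (hR (s, a)) 1)).trans (Nat.le_add_left _ _)
  have hKq : q ≤ K := le_trans (by nlinarith) (Nat.le_add_left (q * (1 + R)) K₁)
  have hE₁ : ∀ s a, E s a ⊆ stdSimplex ℝ S := fun s a => (hE s a).1.trans (M.unc_subset s a)
  have hsafe : ∀ s a p, s ∉ I → p ∈ E s a → SafeMove moveSupp movePos I
      {s' | s' ∉ I ∧ ρ s' < ρ s} {s' | s' ∉ I ∧ ρ s' = ρ s} (M.reward s a, p) →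
      SafeInfo z s (M.reward s a, p) := fun s a p hs hp hmove => by
    refine ⟨fun s' h0 => by rw [hzF s' (hmove.1 s' h0)], ?_⟩
    have hlin : lin (fun s' => (z s').2.1) p =
        lin (fun s' => rankBound R (2 * q) N (ρ s')) p :=
      lin_congr (hE₁ s a hp) fun s' h0 => by rw [hzF s' (hmove.1 s' h0)]
    simp only
    rw [hlin, hzF s hs]
    exact lin_rankBound_add_le (hE₁ s a hp) hN ((hE s a).2.2 p hp) (hR (s, a)) hmove
  have hgood : ∀ s b, s ∈ I → GoodMove moveSupp movePos {s' | s' ∈ I ∧ k s' < k s}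
      {s' | s' ∈ I ∧ k s' = k s} {s' | d s' < d s} b → GoodInfo z s b := fun s b hs hmove => by
    obtain ⟨s', h0, hs'⟩ | ⟨hB, hprog⟩ := hmove
    · exact Or.inl ⟨s', h0, by
        rw [Set.mem_ofPred_eq, hzI s' hs'.1, hzI s hs]; exact ⟨rfl, hs'.2⟩⟩
    · refine Or.inr ⟨fun s' h0 => ?_, hprog.imp id fun ⟨s', h0, hlt⟩ => ⟨s', h0, ?_⟩⟩
      · rw [Set.mem_ofPred_eq, hzI s' (hB s' h0).1, hzI s hs]
        exact ⟨rfl, (hB s' h0).2⟩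
      · rw [Set.mem_ofPred_eq, hzI s' (hB s' h0).1, hzI s hs]
        exact hlt
  refine ⟨K, z, fun s => ?_⟩
  by_cases hs : s ∈ I
  · have hz : (z s).1 = true := by rw [hzI s hs]
    have hens := maxEnsures_of_not_minEnsures (hI s hs)
    cases opt with
    | min =>
      rw [CertifiedAt, if_neg (by simp [hz])]
      intro a ha
      obtain ⟨p, hp, hg⟩ := hens a ha
      exact cell_of_exists_good (hcomp s a) ha (M.unc_subset s a) (hE s a).1 (hE s a).2.1 hz
        (hE s a).2.2 (hKr s a) ⟨p, hp, hgood s _ hs hg⟩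
    | max =>
      rw [CertifiedAt, if_pos (by simp [hz])]
      obtain ⟨a, ha, hg⟩ := hens
      exact ⟨a, ha, cell_of_forall_good (hcomp s a) ha (M.unc_subset s a) (hE s a).1 (hE s a).2.1 hz
        (hE s a).2.2 hKq fun p hp => hgood s _ hs (hg p hp)⟩
  · have hz : (z s).1 = false := by rw [hzF s hs]
    have hens := hF s hs
    cases opt with
    | min =>
      rw [CertifiedAt, if_pos (by simp [hz])]
      obtain ⟨a, ha, hg⟩ := hens
      exact ⟨a, ha, cell_of_forall_safe (hcomp s a) ha (M.unc_subset s a) (hE s a).1 (hE s a).2.1 hz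
        fun p hp => hsafe s a p hs hp (hg p hp)⟩
    | max =>
      rw [CertifiedAt, if_neg (by simp [hz])]
      intro a ha
      obtain ⟨p, hp, hg⟩ := hens a ha
      exact cell_of_exists_safe (hcomp s a) ha (M.unc_subset s a) (hE s a).1 (hE s a).2.1 hz
        (hE s a).2.2 (hKv s) ⟨p, hp, hsafe s a p hs hp hg⟩

end RMDP

/-! ### Computability of the conditions on certificates -/

theorem Primrec.int_ofNat : Primrec fun n : ℕ => (n : ℤ) :=
  Primrec.encode_iff.1 ((Primrec.nat_mul.comp (Primrec.const 2) Primrec.id).of_eq fun _ => rfl)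

theorem PrimrecPred.ite {α : Type*} [Primcodable α] {c p q : α → Prop} [DecidablePred c]
    (hc : PrimrecPred c) (hp : PrimrecPred p) (hq : PrimrecPred q) :
    PrimrecPred fun a => if c a then p a else q a :=
  ((hc.and hp).or (hc.not.and hq)).of_eq fun a => by by_cases h : c a <;> simp [h]

theorem PrimrecPred.imp {α : Type*} [Primcodable α] {p q : α → Prop}
    (hp : PrimrecPred p) (hq : PrimrecPred q) : PrimrecPred fun a => p a → q a :=
  (hp.not.or hq).of_eq fun a => by by_cases h : p a <;> simp [h]

theorem PrimrecPred.exists_lt_of {α : Type*} [Primcodable α] {p : ℕ → α → Prop} {n : α → ℕ}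
    (hn : Primrec n) (hp : PrimrecRel p) : PrimrecPred fun a => ∃ i < n a, p i a :=
  (hp.exists_mem_list.comp (Primrec.list_range.comp hn) Primrec.id).of_eq (by simp)

theorem PrimrecPred.forall_lt_of {α : Type*} [Primcodable α] {p : ℕ → α → Prop} {n : α → ℕ}
    (hn : Primrec n) (hp : PrimrecRel p) : PrimrecPred fun a => ∀ i < n a, p i a :=
  (hp.forall_mem_list.comp (Primrec.list_range.comp hn) Primrec.id).of_eq (by simp)

namespace CellData

open Primrec

theorem primrecPred_isInfinite : PrimrecPred fun y : CellData × StateInfo => y.2.1 = true :=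
  Primrec.eq.comp (fst.comp snd) (const true)

theorem primrecPred_below : PrimrecPred fun y : CellData × StateInfo => y.1.Below y.2 :=
  primrecPred_isInfinite.and (nat_lt.comp (fst.comp (snd.comp snd))
    (fst.comp (snd.comp (snd.comp (snd.comp fst)))))

theorem primrecPred_same : PrimrecPred fun y : CellData × StateInfo => y.1.Same y.2 :=
  primrecPred_isInfinite.and (Primrec.eq.comp (fst.comp (snd.comp snd))
    (fst.comp (snd.comp (snd.comp (snd.comp fst)))))

theorem primrecPred_lower : PrimrecPred fun y : CellData × StateInfo => y.1.Lower y.2 :=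
  nat_lt.comp (snd.comp (snd.comp snd)) (snd.comp (snd.comp (snd.comp (snd.comp fst))))

theorem primrec_fst : Primrec fun y : CellData × StateInfo => y.1.1 := fst.comp fst

theorem primrec_reward : Primrec fun y : CellData × StateInfo => y.1.2.1 :=
  fst.comp (snd.comp fst)

theorem primrec_zero : Primrec₂ zero := Primrec.const 0

theorem primrec_one : Primrec₂ one := Primrec.const 1

theorem primrec_large : Primrec₂ large := primrec_fst

theorem primrec_bound : Primrec₂ bound := fst.comp (snd.comp (snd.comp (snd.comp fst)))

theorem primrec_infinite : Primrec₂ infinite :=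
  Primrec.ite primrecPred_isInfinite (const 1) (const 0)

theorem primrec_below : Primrec₂ below := Primrec.ite primrecPred_below (const 1) (const 0)

theorem primrec_notSame : Primrec₂ notSame := Primrec.ite primrecPred_same (const 0) (const 1)

theorem primrec_cost : Primrec₂ cost :=
  nat_add.comp (Primrec.ite primrecPred_isInfinite primrec_fst (fst.comp (snd.comp snd)))
    primrec_reward

theorem primrec_costPenalty : Primrec₂ costPenalty := nat_add.comp primrec_cost primrec_infinite

theorem primrec_gain : Primrec₂ gain :=
  Primrec.ite primrecPred_same (nat_add.comp primrec_fst
    (nat_add.comp (Primrec.ite primrecPred_lower (const 1) (const 0)) primrec_reward)) (const 0)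

theorem primrec_gainPenalty : Primrec₂ gainPenalty := nat_add.comp primrec_gain primrec_notSame

theorem primrec_stay : Primrec₂ stay :=
  nat_add.comp (Primrec.ite primrecPred_below primrec_fst (const 0))
    (Primrec.ite (primrecPred_below.or primrecPred_same) (const 1) (const 0))

theorem primrec_progress : Primrec₂ progress :=
  nat_add.comp (nat_add.comp (Primrec.ite primrecPred_below primrec_fst (const 0))
    (Primrec.ite primrecPred_lower primrec_fst (const 0))) primrec_reward

/-- The comparison of the `o`-optima of `f` and `g` over the uncertainty set `(s, a)`. -/
def query (zs : List StateInfo) (s a : ℕ) (x : CellData) (o : Opt)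
    (f g : CellData → StateInfo → ℕ) : LinearProblem × LinearProblem :=
  ((o, s, a, zs.map fun z => (f x z : ℤ)), (o, s, a, zs.map fun z => (g x z : ℤ)))

/-- The question has the answer `b`, according to the answers given so far to the questions in
the order of their codes. -/
def KnownAnswer (ans : List Bool) (zs : List StateInfo) (s a : ℕ) (x : CellData) (o : Opt)
    (f g : CellData → StateInfo → ℕ) (b : Bool) : Prop :=
  ans[Encodable.encode (query zs s a x o f g)]? = some b

section

variable {α : Type*} [Primcodable α] {ans : α → List Bool} {zs : α → List StateInfo} {s a : α → ℕ}
  {x : α → CellData}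

theorem primrec_coefficients {f : CellData → StateInfo → ℕ} (hf : Primrec₂ f) (hzs : Primrec zs)
    (hx : Primrec x) : Primrec fun c => (zs c).map fun z => (f (x c) z : ℤ) :=
  list_map hzs (int_ofNat.comp (hf.comp (hx.comp fst) snd))

theorem primrecPred_knownAnswer (hans : Primrec ans) (hzs : Primrec zs) (hs : Primrec s)
    (ha : Primrec a) (hx : Primrec x) (o : Opt) {f g : CellData → StateInfo → ℕ} (hf : Primrec₂ f)
    (hg : Primrec₂ g) (b : Bool) :
    PrimrecPred fun c => KnownAnswer (ans c) (zs c) (s c) (a c) (x c) o f g b :=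
  Primrec.eq.comp (list_getElem?.comp hans (Primrec.encode.comp
    (((const o).pair (hs.pair (ha.pair (primrec_coefficients hf hzs hx)))).pair
      ((const o).pair (hs.pair (ha.pair (primrec_coefficients hg hzs hx))))))) (const (some b))

theorem primrecPred_cell {opt : α → Opt} (hopt : Primrec opt) (hans : Primrec ans)
    (hzs : Primrec zs) (hs : Primrec s) (ha : Primrec a) (hx : Primrec x) :
    PrimrecPred fun c => Cell (KnownAnswer (ans c) (zs c) (s c) (a c) (x c)) (opt c) (x c) := by
  have hmin : PrimrecPred fun c => opt c = .min := Primrec.eq.comp hopt (const Opt.min)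
  have hinf : PrimrecPred fun c => (x c).2.2.1 = true :=
    Primrec.eq.comp (fst.comp (snd.comp (snd.comp hx))) (const true)
  have key := fun o {f g : CellData → StateInfo → ℕ} (hf : Primrec₂ f) (hg : Primrec₂ g) =>
    primrecPred_knownAnswer hans hzs hs ha hx o hf hg
  unfold Cell
  refine .ite hinf (.ite hmin ?_ ?_) (.ite hmin ?_ ?_)
  · exact (key _ primrec_below primrec_zero _).or
      ((key _ primrec_gainPenalty primrec_gain _).and (key _ primrec_gain primrec_large _))
  · exact (key _ primrec_one primrec_stay _).and (key _ primrec_one primrec_progress _)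
  · exact (key _ primrec_infinite primrec_zero _).and (key _ primrec_cost primrec_bound _)
  · exact (key _ primrec_costPenalty primrec_cost _).and (key _ primrec_cost primrec_bound _)

end

end CellData

/-- The input of a procedure. -/
abbrev ProcInput : Type := Opt × RewardTable

/-- A certificate: a large number, a bound on the finite values, and the information about the
states. -/
abbrev Certificate : Type := ℕ × ℕ × List StateInfo

namespace Certificate

open CellData Primrec

/-- The entry of a table of rewards. -/
def entry (T : RewardTable) (s a : ℕ) : Option ℕ := (T.getD s []).getD a none

/-- The information about a state. -/
def info (c : Certificate) (s : ℕ) : StateInfo := c.2.2.getD s (false, 0, 0)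

/-- The data of a state-action pair. -/
def data (c : Certificate) (T : RewardTable) (s a : ℕ) : CellData :=
  (c.1, (entry T s a).getD 0, c.info s)

/-- The condition at a state-action pair is known to hold. -/
def CellKnown (i : ProcInput) (ans : List Bool) (c : Certificate) (s a : ℕ) : Prop :=
  Cell (KnownAnswer ans c.2.2 s a (c.data i.2 s a)) i.1 (c.data i.2 s a)

/-- The condition at a state is known to hold. -/
def StateKnown (i : ProcInput) (ans : List Bool) (c : Certificate) (s : ℕ) : Prop :=
  if (c.info s).1 = true ↔ i.1 = .max then
    ∃ a < (i.2.getD s []).length, (entry i.2 s a).isSome = true ∧ c.CellKnown i ans s a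
  else
    ∀ a < (i.2.getD s []).length, (entry i.2 s a).isSome = true → c.CellKnown i ans s a

/-- The certificate is known to be correct. -/
def Known (i : ProcInput) (ans : List Bool) (c : Certificate) : Prop :=
  c.2.2.length = i.2.length ∧ ∀ s < i.2.length, c.StateKnown i ans s ∧
    ((c.info s).1 = true ∨ (c.info s).2.1 ≤ c.2.1)

/-- The bounds on the values given by a certificate. -/
def output (c : Certificate) : List BoundCode × List BoundCode :=
  (c.2.2.map fun z => if z.1 = true then none else some (0, 0),
    c.2.2.map fun z => if z.1 = true then none else some (c.2.1, 0))

section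

variable {α : Type*} [Primcodable α] {i : α → ProcInput} {ans : α → List Bool}
  {c : α → Certificate} {s a : α → ℕ}

theorem primrec_row (hi : Primrec i) (hs : Primrec s) :
    Primrec fun y => (i y).2.getD (s y) [] :=
  (list_getD []).comp (snd.comp hi) hs

theorem primrec_entry (hi : Primrec i) (hs : Primrec s) (ha : Primrec a) :
    Primrec fun y => entry (i y).2 (s y) (a y) :=
  (list_getD none).comp (primrec_row hi hs) ha

theorem primrec_info (hc : Primrec c) (hs : Primrec s) : Primrec fun y => (c y).info (s y) :=
  (list_getD (false, 0, 0)).comp (snd.comp (snd.comp hc)) hs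

theorem primrec_data (hi : Primrec i) (hc : Primrec c) (hs : Primrec s) (ha : Primrec a) :
    Primrec fun y => (c y).data (i y).2 (s y) (a y) :=
  (fst.comp hc).pair ((option_getD.comp (primrec_entry hi hs ha) (const 0)).pair
    (primrec_info hc hs))

theorem primrecPred_cellKnown (hi : Primrec i) (hans : Primrec ans) (hc : Primrec c)
    (hs : Primrec s) (ha : Primrec a) :
    PrimrecPred fun y => (c y).CellKnown (i y) (ans y) (s y) (a y) :=
  primrecPred_cell (fst.comp hi) hans (snd.comp (snd.comp hc)) hs ha (primrec_data hi hc hs ha)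

theorem primrecPred_infoInfinite (hc : Primrec c) (hs : Primrec s) :
    PrimrecPred fun y => ((c y).info (s y)).1 = true :=
  Primrec.eq.comp (fst.comp (primrec_info hc hs)) (const true)

theorem primrecPred_stateKnown (hi : Primrec i) (hans : Primrec ans) (hc : Primrec c)
    (hs : Primrec s) : PrimrecPred fun y => (c y).StateKnown (i y) (ans y) (s y) := by
  have hinf := primrecPred_infoInfinite hc hs
  have hmax : PrimrecPred fun y => (i y).1 = .max := Primrec.eq.comp (fst.comp hi) (const Opt.max)
  have hlen := list_length.comp (primrec_row hi hs)
  have hsome : PrimrecRel fun (a : ℕ) y => (entry (i y).2 (s y) a).isSome = true :=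
    Primrec.eq.comp (option_isSome.comp (primrec_entry (hi.comp snd) (hs.comp snd) fst))
      (const true)
  have hcell : PrimrecRel fun (a : ℕ) y => (c y).CellKnown (i y) (ans y) (s y) a :=
    primrecPred_cellKnown (hi.comp snd) (hans.comp snd) (hc.comp snd) (hs.comp snd) fst
  refine .ite ?_ (.exists_lt_of hlen (.and hsome hcell)) (.forall_lt_of hlen (.imp hsome hcell))
  exact ((hinf.imp hmax).and (hmax.imp hinf)).of_eq fun y => iff_def.symm

theorem primrecPred_known (hi : Primrec i) (hans : Primrec ans) (hc : Primrec c) :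
    PrimrecPred fun y => (c y).Known (i y) (ans y) := by
  have hlen := list_length.comp (snd.comp hi)
  refine .and (Primrec.eq.comp (list_length.comp (snd.comp (snd.comp hc))) hlen)
    (.forall_lt_of hlen (.and ?_ (.or ?_ ?_)))
  · exact primrecPred_stateKnown (hi.comp snd) (hans.comp snd) (hc.comp snd) fst
  · exact primrecPred_infoInfinite (hc.comp snd) fst
  · exact nat_le.comp (fst.comp (snd.comp (primrec_info (hc.comp snd) fst)))
      (fst.comp (snd.comp (hc.comp snd)))

theorem primrec_output : Primrec output := by
  have hinf : PrimrecPred fun y : Certificate × StateInfo => y.2.1 = true :=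
    Primrec.eq.comp (fst.comp snd) (const true)
  exact (list_map
    (g := fun (_ : Certificate) (z : StateInfo) => if z.1 = true then none else some (0, 0))
    (snd.comp snd) (Primrec.ite hinf (const none) (const (some (0, 0))))).pair
    (list_map
      (g := fun (c : Certificate) (z : StateInfo) => if z.1 = true then none else some (c.2.1, 0))
      (snd.comp snd) (Primrec.ite hinf (const none)
        (option_some.comp ((fst.comp (snd.comp fst)).pair (const 0)))))

end

end Certificate

open Classical in
/-- The output of the first certificate that is known to be correct. -/
noncomputable def searchCertificate (y : ProcInput × List Bool) :
    Option (List BoundCode × List BoundCode) :=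
  ((List.range y.2.length).filterMap fun k =>
    (Encodable.decode (α := Certificate) k).bind fun c =>
      if c.Known y.1 y.2 then some c.output else none).head?

/-- The comparison with code `k`. -/
def nthQuery (k : ℕ) : LinearProblem × LinearProblem :=
  (Encodable.decode (α := LinearProblem × LinearProblem) k).getD
    ((.max, 0, 0, []), (.max, 0, 0, []))

theorem primrec_searchCertificate : Primrec searchCertificate := by
  classical
  open Primrec in
  refine list_head?.comp (listFilterMap (list_range.comp (list_length.comp snd))
    (option_bind (Primrec.decode.comp snd) (Primrec.ite ?_
      (option_some.comp (Certificate.primrec_output.comp snd)) (const none))))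
  exact Certificate.primrecPred_known (fst.comp (fst.comp fst)) (snd.comp (fst.comp fst)) snd

/-- The procedure asks all questions in the order of their codes, until a certificate is known to
be correct. -/
noncomputable def searchProcedure : Procedure where
  next y :=
    match searchCertificate y with
    | some lu => Sum.inr lu
    | none => Sum.inl (nthQuery y.2.length)
  computable_next := by
    have hq : Primrec nthQuery :=
      Primrec.option_getD.comp Primrec.decode (Primrec.const _)
    refine Primrec.to_comp ((Primrec.option_casesOn primrec_searchCertificate
      (Primrec.sumInl.comp (hq.comp (Primrec.list_length.comp Primrec.snd)))
      (Primrec.sumInr.comp Primrec.snd).to₂).of_eq fun y => ?_)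
    cases searchCertificate y <;> rfl

/-! ### Correctness of the procedure -/

section Correct

open CellData Certificate Filter

theorem CellData.Cell.mono
    {ask ask' : Opt → (CellData → StateInfo → ℕ) → (CellData → StateInfo → ℕ) → Bool → Prop}
    (h : ∀ o f g b, ask o f g b → ask' o f g b) {opt : Opt} {x : CellData} (hx : Cell ask opt x) :
    Cell ask' opt x := by
  unfold Cell at hx ⊢
  split_ifs at hx ⊢
  · exact hx.imp (h _ _ _ _) (And.imp (h _ _ _ _) (h _ _ _ _))
  all_goals exact hx.imp (h _ _ _ _) (h _ _ _ _)

theorem CellData.Cell.eventually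
    {ask : Opt → (CellData → StateInfo → ℕ) → (CellData → StateInfo → ℕ) → Bool → Prop}
    {ask' : ℕ → Opt → (CellData → StateInfo → ℕ) → (CellData → StateInfo → ℕ) → Bool → Prop}
    (h : ∀ o f g b, ask o f g b → ∀ᶠ K in atTop, ask' K o f g b) {opt : Opt} {x : CellData}
    (hx : Cell ask opt x) : ∀ᶠ K in atTop, Cell (ask' K) opt x := by
  unfold Cell at hx ⊢
  split_ifs at hx ⊢
  · obtain hx | hx := hx
    · exact (h _ _ _ _ hx).mono fun K => Or.inl
    · exact ((h _ _ _ _ hx.1).and (h _ _ _ _ hx.2)).mono fun K => Or.inr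
  all_goals exact (h _ _ _ _ hx.1).and (h _ _ _ _ hx.2)

namespace RMDP

variable {n m : ℕ} (M : RMDP (Fin n) (Fin m))

/-- The correct answers to the first `K` questions. -/
noncomputable def trueAnswers (K : ℕ) : List Bool :=
  (List.range K).map fun k => M.answer (nthQuery k)

theorem length_trueAnswers (K : ℕ) : (M.trueAnswers K).length = K := by simp [trueAnswers]

theorem take_trueAnswers {k K : ℕ} (h : k ≤ K) :
    (M.trueAnswers K).take k = M.trueAnswers k := by
  rw [trueAnswers, ← List.map_take, List.take_range, min_eq_left h, trueAnswers]

variable {M}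

theorem optimum_eq_optVal (c : Certificate) (hc : c.2.2.length = n) (s : Fin n) (a : Fin m)
    (x : CellData) (o : Opt) (f : CellData → StateInfo → ℕ) :
    M.optimum (o, s, a, c.2.2.map fun z => (f x z : ℤ)) =
      optVal o (M.unc s a) fun s' => f x (c.info s') := by
  have hfun : (fun p : Fin n → ℝ => ∑ s' : Fin n,
      (((c.2.2.map fun z => (f x z : ℤ)).getD s' 0 : ℤ) : ℝ) * p s') =
      lin fun s' : Fin n => f x (c.info s') := by
    funext p
    refine Finset.sum_congr rfl fun s' _ => ?_
    have hlt : (s' : ℕ) < c.2.2.length := hc ▸ s'.2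
    congr 1
    simp [info, List.getD, hlt]
  have hsa : (s : ℕ) < n ∧ (a : ℕ) < m := ⟨s.2, a.2⟩
  unfold optimum
  simp only [dif_pos hsa, hfun]
  cases o <;> rfl

theorem knownAnswer_iff (c : Certificate) (hc : c.2.2.length = n) (s : Fin n) (a : Fin m)
    (x : CellData) (o : Opt) (f g : CellData → StateInfo → ℕ) (b : Bool) (K : ℕ) :
    KnownAnswer (M.trueAnswers K) c.2.2 s a x o f g b ↔
      Encodable.encode (query c.2.2 s a x o f g) < K ∧
        TrueAnswer (M.unc s a) (fun s' : Fin n => c.info s') x o f g b := by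
  have hnth : ∀ q, nthQuery (Encodable.encode q) = q := fun q => by
    simp [nthQuery, Encodable.encodek]
  have hans : M.answer (query c.2.2 s a x o f g) = b ↔
      TrueAnswer (M.unc s a) (fun s' : Fin n => c.info s') x o f g b := by
    rw [TrueAnswer, answer, query]
    simp only [optimum_eq_optVal c hc]
    cases b <;> simp
  rw [KnownAnswer, trueAnswers, ← hans]
  by_cases hlt : Encodable.encode (query c.2.2 s a x o f g) < K
  · simp [hlt, hnth]
  · simp [hlt]

theorem length_table : M.table.length = n := by simp [table]

theorem length_table_row (s : Fin n) : (M.table.getD s []).length = m := by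
  simp [table, List.getD]

open Classical in
theorem entry_table (s : Fin n) (a : Fin m) :
    entry M.table s a = if M.Available s a then some (M.reward s a) else none := by
  simp [table, entry, List.getD]

theorem data_table (c : Certificate) {s : Fin n} {a : Fin m} (ha : M.Available s a) :
    c.data M.table s a = (c.1, M.reward s a, c.info s) := by
  simp [data, entry_table, ha]

theorem isSome_entry_table {s : Fin n} {a : Fin m} :
    (entry M.table s a).isSome = true ↔ M.Available s a := by
  rw [entry_table]
  split_ifs with h <;> simp [h]

theorem stateKnown_iff (c : Certificate) (opt : Opt) (ans : List Bool) (s : Fin n) :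
    c.StateKnown (opt, M.table) ans s ↔
      if (c.info s).1 = true ↔ opt = .max then
        ∃ a : Fin m, M.Available s a ∧ c.CellKnown (opt, M.table) ans s a
      else ∀ a : Fin m, M.Available s a → c.CellKnown (opt, M.table) ans s a := by
  unfold StateKnown
  simp only [length_table_row]
  split_ifs
  · constructor
    · rintro ⟨a, ha, h1, h2⟩
      exact ⟨⟨a, ha⟩, isSome_entry_table.1 h1, h2⟩
    · rintro ⟨a, h1, h2⟩
      exact ⟨a, a.2, isSome_entry_table.2 h1, h2⟩
  · constructor
    · exact fun h a h1 => h a a.2 (isSome_entry_table.2 h1)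
    · exact fun h a ha h1 => h ⟨a, ha⟩ (isSome_entry_table.1 h1)

theorem certifiedAt_of_known {c : Certificate} {opt : Opt} {K : ℕ}
    (h : c.Known (opt, M.table) (M.trueAnswers K)) (s : Fin n) :
    M.CertifiedAt opt c.1 (fun s' : Fin n => c.info s') s := by
  have hlen : c.2.2.length = n := h.1.trans length_table
  have hs := (stateKnown_iff c opt _ s).1 (h.2 s (by rw [length_table]; exact s.2)).1
  have hcell : ∀ a, M.Available s a → c.CellKnown (opt, M.table) (M.trueAnswers K) s a →
      Cell (TrueAnswer (M.unc s a) (fun s' : Fin n => c.info s') (c.1, M.reward s a, c.info s))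
        opt (c.1, M.reward s a, c.info s) := fun a ha hk => by
    rw [CellKnown, data_table c ha] at hk
    exact hk.mono fun o f g b hb => ((knownAnswer_iff c hlen s a _ o f g b K).1 hb).2
  unfold CertifiedAt
  split_ifs at hs ⊢
  · obtain ⟨a, ha, hk⟩ := hs
    exact ⟨a, ha, hcell a ha hk⟩
  · exact fun a ha => hcell a ha (hs a ha)

theorem eventually_known {c : Certificate} {opt : Opt} (hlen : c.2.2.length = n)
    (h : ∀ s, M.CertifiedAt opt c.1 (fun s' : Fin n => c.info s') s)
    (hT : ∀ s : Fin n, (c.info s).2.1 ≤ c.2.1) :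
    ∀ᶠ K in atTop, c.Known (opt, M.table) (M.trueAnswers K) := by
  have hcell : ∀ (s : Fin n) (a : Fin m), M.Available s a →
      Cell (TrueAnswer (M.unc s a) (fun s' : Fin n => c.info s') (c.1, M.reward s a, c.info s))
        opt (c.1, M.reward s a, c.info s) →
      ∀ᶠ K in atTop, c.CellKnown (opt, M.table) (M.trueAnswers K) s a := fun s a ha hk => by
    unfold CellKnown
    rw [data_table c ha]
    refine hk.eventually fun o f g b hb => ?_
    filter_upwards [eventually_gt_atTop
      (Encodable.encode (query c.2.2 s a (c.1, M.reward s a, c.info s) o f g))] with K hK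
    exact (knownAnswer_iff c hlen s a _ o f g b K).2 ⟨hK, hb⟩
  have hstate : ∀ s : Fin n, ∀ᶠ K in atTop, c.StateKnown (opt, M.table) (M.trueAnswers K) s := by
    intro s
    simp only [stateKnown_iff]
    have hs := h s
    unfold CertifiedAt at hs
    split_ifs at hs ⊢
    · obtain ⟨a, ha, hk⟩ := hs
      exact (hcell s a ha hk).mono fun K hK => ⟨a, ha, hK⟩
    · rw [eventually_all]
      intro a
      by_cases ha : M.Available s a
      · exact (hcell s a ha (hs a ha)).mono fun K hK _ => hK
      · exact Eventually.of_forall fun K h => absurd h ha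
  filter_upwards [eventually_all.2 hstate] with K hK
  refine ⟨hlen.trans length_table.symm, fun s hs => ?_⟩
  have hs' : s < n := by simpa [length_table] using hs
  exact ⟨hK ⟨s, hs'⟩, Or.inr (hT ⟨s, hs'⟩)⟩

theorem searchCertificate_eq_some {opt : Opt} {K : ℕ} {lu : List BoundCode × List BoundCode}
    (h : searchCertificate ((opt, M.table), M.trueAnswers K) = some lu) :
    ∃ c : Certificate, c.Known (opt, M.table) (M.trueAnswers K) ∧ c.output = lu := by
  have := List.mem_of_head? h
  rw [List.mem_filterMap] at this
  obtain ⟨k, -, hk⟩ := this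
  rw [Option.bind_eq_some_iff] at hk
  obtain ⟨c, -, hc⟩ := hk
  split_ifs at hc with hknown
  exact ⟨c, hknown, Option.some_injective _ hc⟩

theorem searchCertificate_ne_none {c : Certificate} {opt : Opt} {K : ℕ}
    (hK : Encodable.encode c < K) (h : c.Known (opt, M.table) (M.trueAnswers K)) :
    searchCertificate ((opt, M.table), M.trueAnswers K) ≠ none := by
  unfold searchCertificate
  rw [Ne, List.head?_eq_none_iff]
  refine List.ne_nil_of_mem (a := c.output) (List.mem_filterMap.2
    ⟨Encodable.encode c, by simpa [length_trueAnswers] using hK, ?_⟩)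
  rw [Encodable.encodek]
  exact if_pos h

theorem exists_known (h : M.IsPolytopic ∨ M.IsClosed ∧ M.ConstantSupport) (opt : Opt) :
    ∃ c : Certificate, ∀ᶠ K in atTop, c.Known (opt, M.table) (M.trueAnswers K) := by
  obtain ⟨K, z, hz⟩ := exists_certified h opt
  obtain ⟨T, hT⟩ : ∃ T, ∀ s, (z s).2.1 ≤ T :=
    exists_forall_of_monotone (fun _ _ _ h h' => le_trans h' h) fun s => ⟨_, le_rfl⟩
  let c : Certificate := (K, T, List.ofFn z)
  have hinfo : ∀ s : Fin n, c.info s = z s := fun s => by simp [c, info, List.getD]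
  have hinfo' : (fun s : Fin n => c.info s) = z := funext hinfo
  exact ⟨c, eventually_known (by simp [c]) (by rw [hinfo']; exact hz)
    fun s => by rw [hinfo]; exact hT s⟩

end RMDP

end Correct

theorem mainTheorem8 :
    ∃ initTR : Procedure, ∀ (n m : ℕ) (M : RMDP (Fin n) (Fin m)) (opt : Opt),
      M.IsPolytopic ∨ (M.IsClosed ∧ M.ConstantSupport) →
      ∃ L U : Fin n → WithTop ℚ, initTR.Computes M opt L U ∧
        (∀ s, M.value opt s = ⊤ → L s = ⊤ ∧ U s = ⊤) ∧
        ∃ t : ℚ, (∀ s, M.value opt s ≠ ⊤ → (M.value opt s).toReal ≤ (t : ℝ)) ∧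
          ∀ s, M.value opt s ≠ ⊤ → L s = 0 ∧ U s = (t : WithTop ℚ) := by
  classical
  refine ⟨searchProcedure, fun n m M opt h => ?_⟩
  have hcomp := RMDP.isCompact_unc h
  have hex : ∃ K, searchCertificate ((opt, M.table), M.trueAnswers K) ≠ none := by
    obtain ⟨c, hc⟩ := RMDP.exists_known h opt
    obtain ⟨K, hK, hlt⟩ :=
      (hc.and (Filter.eventually_gt_atTop (Encodable.encode c))).exists
    exact ⟨K, RMDP.searchCertificate_ne_none hlt hK⟩
  obtain ⟨lu, hlu⟩ := Option.ne_none_iff_exists'.1 (Nat.find_spec hex)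
  obtain ⟨c, hknown, rfl⟩ := RMDP.searchCertificate_eq_some hlu
  have hcert := RMDP.certifiedAt_of_known hknown
  have hlen : c.2.2.length = n := hknown.1.trans RMDP.length_table
  have hget : ∀ s : Fin n, c.2.2[(s : ℕ)]'(hlen ▸ s.2) = c.info s := fun s => by
    simp [Certificate.info, List.getD, hlen]
  have htop : ∀ s : Fin n, (c.info s).1 = true → M.value opt s = ⊤ := fun s hs =>
    RMDP.value_eq_top_of_certified hcomp hcert hs
  have hfin : ∀ s : Fin n, (c.info s).1 = false → M.value opt s ≤ (c.info s).2.1 := fun s hs =>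
    RMDP.value_le_of_certified hcomp hcert hs
  have hinf : ∀ s : Fin n, M.value opt s = ⊤ → (c.info s).1 = true := fun s hs => by
    by_contra hne
    have := hfin s (by simpa using hne)
    rw [hs, top_le_iff] at this
    exact ENNReal.natCast_ne_top _ this
  have hfin' : ∀ s : Fin n, M.value opt s ≠ ⊤ → (c.info s).1 = false := fun s hs => by
    by_contra hne
    exact hs (htop s (by simpa using hne))
  refine ⟨fun s => if (c.info s).1 = true then ⊤ else 0,
    fun s => if (c.info s).1 = true then ⊤ else ((c.2.1 : ℚ) : WithTop ℚ),
    ⟨M.trueAnswers (Nat.find hex), c.output.1, c.output.2, fun k hk => ?_, ?_, ?_, ?_⟩,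
    fun s hs => ?_, c.2.1, fun s hs => ?_, fun s hs => ?_⟩
  · have hk' : k < Nat.find hex := by simpa [RMDP.length_trueAnswers] using hk
    refine ⟨nthQuery k, ?_, by simp [RMDP.trueAnswers]⟩
    have hnone := not_not.1 (Nat.find_min hex hk')
    rw [RMDP.take_trueAnswers M hk'.le]
    simp only [searchProcedure]
    rw [hnone, RMDP.length_trueAnswers]
  · simp only [searchProcedure]
    rw [hlu]
  · refine List.ext_getElem (by simp [Certificate.output, hlen]) fun s h1 h2 => ?_
    have hs : s < n := by simpa using h2
    have hs' := hget ⟨s, hs⟩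
    simp only at hs'
    simp only [Certificate.output, List.getElem_map, List.getElem_ofFn, hs']
    split_ifs <;> simp [BoundCode.denote]
  · refine List.ext_getElem (by simp [Certificate.output, hlen]) fun s h1 h2 => ?_
    have hs : s < n := by simpa using h2
    have hs' := hget ⟨s, hs⟩
    simp only at hs'
    simp only [Certificate.output, List.getElem_map, List.getElem_ofFn, hs']
    split_ifs <;> simp [BoundCode.denote]
  · simp [hinf s hs]
  · have h1 := hfin s (hfin' s hs)
    have h2 : (c.info s).2.1 ≤ c.2.1 :=
      (hknown.2 s (by rw [RMDP.length_table]; exact s.2)).2.resolve_left (by simp [hfin' s hs])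
    have h3 := ENNReal.toReal_mono (ENNReal.natCast_ne_top _) (h1.trans (Nat.cast_le.2 h2))
    simpa using h3
  · simp [hfin' s hs]
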